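/- Let $\mathcal K$ be the class of nonconstant power series $\psi(z)=\sum_{n\ge 0} b_n z^n$ with $b_n\ge 0$ for all $n$, $b_0>0$, and radius of convergence $R\in(0,\infty]$. For $t\in[0,R)$ put $m(t)=t\psi'(t)/\psi(t)$, and let $\mathcal K^\star$ be the class of those $\psi\in\mathcal K$ for which $\lim_{t\uparrow R}m(t)>1$ (the limit, possibly $+\infty$, exists since $m$ is increasing). The apex of $\psi\in\mathcal K^\star$ is the unique $\tau\in(0,R)$ with $m(\tau)=1$. Theorem. Let $\psi(z)=\sum_{n\ge 0}b_nz^n\in\mathcal K^\star$ have apex $\tau$, let $\rho=\tau/\psi(\tau)$, and let $Q_\psi=\gcd\{n>0:\ b_n>0\}$. Let $g(z)=\sum_{n\ge 1}A_nz^n$ be the unique power series with $g(z)=z\,\psi(g(z))$. Define power series $g_k(z)=\sum_{n\ge1}A_n^{(k)}z^n$ recursively by $g_0=g$ and $g_k(z)=z\,[\psi(g_{k-1}(z))-b_0]$ for $k\ge 1$. Let $G(z,w)=z(\psi(w)-b_0)$, and let $G_k$ be its iterates in the second variable: $G_0(z,w)=w$ and $G_k(z,w)=G(z,G_{k-1}(z,w))$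 for $k\ge1$. Then, for every $k\ge 0$, the function $w\mapsto G_k(\rho,w)$ is complex differentiable at $w=\tau$, and $$\lim_{\substack{n\to\infty\\ n\equiv 1 \bmod Q_\psi}}\frac{A_n^{(k)}}{A_n}=\frac{\partial G_k}{\partial w}(\rho,\tau).$$ -/

import Mathlib

open Filter Topology

noncomputable section

namespace Khinchin

/-- The radius of convergence (in `[0, ∞]`) of a power series with real coefficients. -/
def radius (f : PowerSeries ℝ) : ENNReal :=
  (FormalMultilinearSeries.ofScalars ℝ (fun n : ℕ => PowerSeries.coeff n f)).radius

/-- The value `f(z) = ∑ aₙ zⁿ` of a real power series at a real or complex point `z`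
(meaningful where the series converges). -/
def value {𝕜 : Type*} [RCLike 𝕜] (f : PowerSeries ℝ) (z : 𝕜) : 𝕜 :=
  ∑' n : ℕ, ((PowerSeries.coeff n f : ℝ) : 𝕜) * z ^ n

/-- The class `K`: nonconstant power series with nonnegative coefficients, positive
constant term and positive radius of convergence. -/
structure ClassK (f : PowerSeries ℝ) : Prop where
  coeff_nonneg : ∀ n : ℕ, 0 ≤ PowerSeries.coeff n f
  coeff_zero_pos : 0 < PowerSeries.coeff 0 f
  nonconstant : ∃ n : ℕ, 0 < n ∧ PowerSeries.coeff n f ≠ 0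
  radius_pos : 0 < radius f

/-- The mean `m(t) = E(X_t)` of the Khinchin family of `f`, where
`P(X_t = n) = aₙ tⁿ / f(t)`; it equals `t f'(t) / f(t)`. -/
def mean (f : PowerSeries ℝ) (t : ℝ) : ℝ :=
  ∑' n : ℕ, (n : ℝ) * (PowerSeries.coeff n f * t ^ n / value f t)

/-- The class `K*`: series `f` in `K`, with radius of convergence `R` (possibly infinite), such
that `lim_{t ↑ R} m(t)`, an extended real number, is larger than `1`. -/
structure ClassKStar (f : PowerSeries ℝ) : Prop extends ClassK f where
  one_lt_lim_mean : ∃ L : EReal, 1 < L ∧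
    Tendsto (fun t : ℝ => (mean f t : EReal)) (comap ENNReal.ofReal (𝓝[<] (radius f))) (𝓝 L)

/-- `τ` is the apex of `f`: `0 < τ < R` and `m(τ) = 1`. -/
structure IsApex (f : PowerSeries ℝ) (τ : ℝ) : Prop where
  pos : 0 < τ
  lt_radius : ENNReal.ofReal τ < radius f
  mean_eq_one : mean f τ = 1

/-- `Q_f`, the greatest common divisor of the indices `n > 0` with `aₙ > 0`. -/
def period (f : PowerSeries ℝ) : ℕ :=
  sSup {d : ℕ | ∀ n : ℕ, 0 < n → 0 < PowerSeries.coeff n f → d ∣ n}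

/-- `g` is the power series solution of Lagrange's equation `g(z) = z ψ(g(z))`. The constant
term of `g` vanishes, so `ψ(g(z))` is a composition of formal power series. -/
structure IsLagrangeSolution (ψ g : PowerSeries ℝ) : Prop where
  coeff_zero : PowerSeries.coeff 0 g = 0
  equation : g = PowerSeries.X * PowerSeries.subst g ψ

/-- The scheme `g₀ = g`, `g_k(z) = z [ψ(g_{k-1}(z)) - b₀]`, where `b₀ = ψ(0)`. -/
def iterSeries (ψ g : PowerSeries ℝ) : ℕ → PowerSeries ℝ
  | 0 => g
  | k + 1 => PowerSeries.X *
      (PowerSeries.subst (iterSeries ψ g k) ψ - PowerSeries.C (PowerSeries.coeff 0 ψ))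

/-- The bivariate function `G(z, w) = z (ψ(w) - b₀)`. -/
def G (ψ : PowerSeries ℝ) (z w : ℂ) : ℂ :=
  z * (value ψ w - ((PowerSeries.coeff 0 ψ : ℝ) : ℂ))

/-- The iterates of `G` in the second variable: `G₀(z, w) = w`,
`G_k(z, w) = G(z, G_{k-1}(z, w))`. -/
def iterG (ψ : PowerSeries ℝ) : ℕ → ℂ → ℂ → ℂ
  | 0, _, w => w
  | k + 1, z, w => G ψ z (iterG ψ k z w)

end Khinchin

end

/-!
Write `A_n` for the coefficients of `g`. The theorem follows from the fact that the rescaled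
coefficients `A_n ρ ^ n` have sum `τ` and satisfy `n ^ (3/2) A_n ρ ^ n → c > 0` along
`n ≡ 1 mod Q`, together with a calculus for power series whose coefficients decay in this way.

The calculus (`CoeffAsymp`): suppose that nonnegative `f_n`, supported on a residue class modulo
`Q`, have sum `S` and satisfy `n ^ (3/2) f_n → c` along that class. In a convolution of two such
sequences only the terms in which one of the two indices stays bounded survive in the limit, so the
constant obeys the product rule (`CoeffAsymp.mul`). With the bound `CoeffAsymp.pow_bound` for the
powers `f ^ j`, dominated convergence gives the chain rule `c ↦ ψ'(S) c` for `ψ(f)`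
(`CoeffAsymp.subst`). Hence the constant of `g_k(ρ z) = ρ z (ψ(g_{k-1}(ρ z)) - b₀)` obeys the same
recursion as `∂G_k/∂w (ρ, τ)`, while the coefficient sum of `g_k(ρ z)` obeys that of `G_k(ρ, τ)`
(`exists_coeffAsymp_iterSeries`), and the quotient of the constants of `g_k` and `g` is the limit.

The asymptotics of `A_n`: by Lagrange inversion (`IsLagrangeSolution.coeff_pow`),
`A_n ρ ^ n = (τ / n) P(S_n = n - 1)`, where `S_n` is a sum of `n` independent variables with law
`P(X = j) = b_j τ ^ j / ψ(τ)`. At the apex this law has mean `1`, and a local limit theorem on the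
lattice `Q ℤ`, proved by Fourier inversion, gives `√n P(S_n = n - 1) → K > 0`
(`CriticalLaw.tendsto_sqrt_mul_coeff`). The sum `T` of the `A_n ρ ^ n` is at most `τ` and
`T / τ` is a fixed point of the generating function of the law, so that `T = τ` by strict convexity
(`eq_one_of_fixed_point`).
-/

namespace Khinchin

/-! ### Products of power series: values and supports -/

/-- The value at `z` is multiplicative where both series converge absolutely. -/
theorem summable_norm_mul_and_value_mul {𝕜 : Type*} [RCLike 𝕜] {f g : PowerSeries ℝ} {z : 𝕜}
    (hf : Summable fun n => ‖((PowerSeries.coeff n f : ℝ) : 𝕜) * z ^ n‖)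
    (hg : Summable fun n => ‖((PowerSeries.coeff n g : ℝ) : 𝕜) * z ^ n‖) :
    (Summable fun n => ‖((PowerSeries.coeff n (f * g) : ℝ) : 𝕜) * z ^ n‖) ∧
      value (f * g) z = value f z * value g z := by
  have key : ∀ n, ((PowerSeries.coeff n (f * g) : ℝ) : 𝕜) * z ^ n =
      ∑ kl ∈ Finset.HasAntidiagonal.antidiagonal n,
        (((PowerSeries.coeff kl.1 f : ℝ) : 𝕜) * z ^ kl.1) *
        (((PowerSeries.coeff kl.2 g : ℝ) : 𝕜) * z ^ kl.2) := by
    intro n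
    rw [PowerSeries.coeff_mul]
    push_cast
    rw [Finset.sum_mul]
    refine Finset.sum_congr rfl fun kl hkl => ?_
    rw [← Finset.HasAntidiagonal.mem_antidiagonal.1 hkl, pow_add]
    ring
  constructor
  · have h := summable_norm_sum_mul_antidiagonal_of_summable_norm hf hg
    exact h.congr fun n => congrArg norm (key n).symm
  · simp only [value]
    rw [tsum_mul_tsum_eq_tsum_sum_antidiagonal_of_summable_norm hf hg]
    exact tsum_congr key

theorem summable_norm_pow_and_value_pow {𝕜 : Type*} [RCLike 𝕜] {f : PowerSeries ℝ} {z : 𝕜}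
    (hf : Summable fun n => ‖((PowerSeries.coeff n f : ℝ) : 𝕜) * z ^ n‖) (j : ℕ) :
    (Summable fun n => ‖((PowerSeries.coeff n (f ^ j) : ℝ) : 𝕜) * z ^ n‖) ∧
      value (f ^ j) z = value f z ^ j := by
  induction j with
  | zero =>
    have h : ∀ n, n ≠ 0 → ((PowerSeries.coeff n (1 : PowerSeries ℝ) : ℝ) : 𝕜) * z ^ n = 0 := by
      intro n hn
      simp [PowerSeries.coeff_one, hn]
    constructor
    · refine summable_of_ne_finset_zero (s := {0}) fun n hn => ?_
      rw [pow_zero, h n (by simpa using hn), norm_zero]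
    · simp only [value, pow_zero]
      rw [tsum_eq_single 0 h]
      simp
  | succ j ih =>
    have := summable_norm_mul_and_value_mul ih.1 hf
    rw [pow_succ, pow_succ, this.2, ih.2]
    exact ⟨this.1, rfl⟩

theorem hasSum_coeff_mul {f g : PowerSeries ℝ} {S T : ℝ}
    (hf : HasSum (fun n => PowerSeries.coeff n f) S)
    (hg : HasSum (fun n => PowerSeries.coeff n g) T) :
    HasSum (fun n => PowerSeries.coeff n (f * g)) (S * T) := by
  have h := summable_norm_mul_and_value_mul (f := f) (g := g) (z := (1 : ℝ))
    (by simpa using hf.summable.abs) (by simpa using hg.summable.abs)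
  have h1 : Summable fun n => PowerSeries.coeff n (f * g) := by
    have := h.1
    simp only [RCLike.ofReal_real_eq_id, id_eq, one_pow, mul_one] at this
    exact this.of_norm
  have h2 := h.2
  simp only [value, RCLike.ofReal_real_eq_id, id_eq, one_pow, mul_one, hf.tsum_eq,
    hg.tsum_eq] at h2
  rw [← h2]
  exact h1.hasSum

theorem coeff_mul_nonneg {f g : PowerSeries ℝ}
    (hf : ∀ n, 0 ≤ PowerSeries.coeff n f) (hg : ∀ n, 0 ≤ PowerSeries.coeff n g) (n : ℕ) :
    0 ≤ PowerSeries.coeff n (f * g) := by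
  rw [PowerSeries.coeff_mul]
  exact Finset.sum_nonneg fun kl _ => mul_nonneg (hf _) (hg _)

theorem coeff_one_nonneg (n : ℕ) : 0 ≤ PowerSeries.coeff n (1 : PowerSeries ℝ) := by
  rw [PowerSeries.coeff_one]
  split_ifs <;> norm_num

theorem coeff_pow_nonneg {f : PowerSeries ℝ} (hf : ∀ n, 0 ≤ PowerSeries.coeff n f) (j n : ℕ) :
    0 ≤ PowerSeries.coeff n (f ^ j) := by
  induction j generalizing n with
  | zero => rw [pow_zero]; exact coeff_one_nonneg n
  | succ j ih => rw [pow_succ]; exact coeff_mul_nonneg ih hf n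

/-- The exponents of `f` all lie in the residue class of `r` modulo `Q`. -/
def SuppMod (Q r : ℕ) (f : PowerSeries ℝ) : Prop :=
  ∀ n, PowerSeries.coeff n f ≠ 0 → n ≡ r [MOD Q]

theorem SuppMod.mul {Q r s : ℕ} {f g : PowerSeries ℝ} (hf : SuppMod Q r f) (hg : SuppMod Q s g) :
    SuppMod Q (r + s) (f * g) := by
  intro n hn
  rw [PowerSeries.coeff_mul] at hn
  obtain ⟨kl, hkl, h⟩ := Finset.exists_ne_zero_of_sum_ne_zero hn
  rw [← Finset.HasAntidiagonal.mem_antidiagonal.1 hkl]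
  exact (hf _ (left_ne_zero_of_mul h)).add (hg _ (right_ne_zero_of_mul h))

theorem SuppMod.one (Q : ℕ) : SuppMod Q 0 1 := by
  intro n hn
  rw [PowerSeries.coeff_one] at hn
  have : n = 0 := by simpa using hn
  rw [this]

theorem SuppMod.pow {Q r : ℕ} {f : PowerSeries ℝ} (hf : SuppMod Q r f) (j : ℕ) :
    SuppMod Q (j * r) (f ^ j) := by
  induction j with
  | zero => simpa using SuppMod.one Q
  | succ j ih => rw [pow_succ, Nat.succ_mul]; exact ih.mul hf

/-! ### Power series with coefficients asymptotic to `c n ^ (-3/2)` on a residue class -/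

/-- The weight `n ^ (3/2)`. -/
noncomputable def threeHalves (n : ℕ) : ℝ := n * √n

theorem threeHalves_nonneg (n : ℕ) : 0 ≤ threeHalves n := by unfold threeHalves; positivity

theorem threeHalves_pos {n : ℕ} (hn : 0 < n) : 0 < threeHalves n := by
  unfold threeHalves; positivity

theorem threeHalves_mono {m n : ℕ} (h : m ≤ n) : threeHalves m ≤ threeHalves n := by
  unfold threeHalves; gcongr

theorem threeHalves_mul (m n : ℕ) : threeHalves (m * n) = threeHalves m * threeHalves n := by
  unfold threeHalves
  rw [Nat.cast_mul, Real.sqrt_mul (Nat.cast_nonneg m)]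
  ring

theorem threeHalves_le_sq (n : ℕ) : threeHalves n ≤ (n : ℝ) ^ 2 := by
  unfold threeHalves
  rcases Nat.eq_zero_or_pos n with rfl | hn
  · simp
  · rw [sq]
    have : (1 : ℝ) ≤ n := by exact_mod_cast hn
    gcongr
    exact Real.sqrt_le_iff.2 ⟨by positivity, by nlinarith⟩

theorem tendsto_threeHalves_div (i : ℕ) :
    Tendsto (fun n => threeHalves n / threeHalves (n - i)) atTop (𝓝 1) := by
  have h1 : Tendsto (fun n : ℕ => (n : ℝ) / ((n - i : ℕ) : ℝ)) atTop (𝓝 1) := by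
    have h : Tendsto (fun m : ℕ => 1 + (i : ℝ) / (m : ℝ)) atTop (𝓝 (1 + 0)) :=
      tendsto_const_nhds.add (tendsto_const_div_atTop_nhds_zero_nat _)
    rw [add_zero] at h
    refine (h.comp (tendsto_sub_atTop_nat i)).congr' ?_
    filter_upwards [eventually_gt_atTop i] with n hn
    have : (0 : ℝ) < ((n - i : ℕ) : ℝ) := by exact_mod_cast Nat.sub_pos_of_lt hn
    simp only [Function.comp]
    rw [eq_div_iff this.ne', add_mul, div_mul_cancel₀ _ this.ne', one_mul]
    rw [Nat.cast_sub hn.le]; ring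
  have h2 := h1.mul h1.sqrt
  rw [Real.sqrt_one, one_mul] at h2
  refine h2.congr fun n => ?_
  unfold threeHalves
  rw [Real.sqrt_div (Nat.cast_nonneg n), div_mul_div_comm]

/-- The coefficients `fₙ ≥ 0` of `f` have sum `S`, live on the residue class of `r` modulo `Q`,
and satisfy `n ^ (3/2) fₙ → c` along that class. -/
structure CoeffAsymp (Q r : ℕ) (f : PowerSeries ℝ) (c S : ℝ) : Prop where
  nonneg : ∀ n, 0 ≤ PowerSeries.coeff n f
  supp : SuppMod Q r f
  hasSum : HasSum (fun n => PowerSeries.coeff n f) S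
  tendsto : Tendsto (fun n => threeHalves n * PowerSeries.coeff n f)
    (atTop ⊓ 𝓟 {n | n ≡ r [MOD Q]}) (𝓝 c)

theorem CoeffAsymp.exists_bound {Q r : ℕ} {f : PowerSeries ℝ} {c S : ℝ}
    (h : CoeffAsymp Q r f c S) :
    ∃ C, 0 ≤ C ∧ ∀ n, threeHalves n * PowerSeries.coeff n f ≤ C := by
  have h1 : ∀ᶠ n in atTop, threeHalves n * PowerSeries.coeff n f ≤ |c| + 1 := by
    have := h.tendsto.eventually
      (eventually_le_nhds (lt_of_le_of_lt (le_abs_self c) (lt_add_one _)))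
    rw [eventually_inf_principal] at this
    filter_upwards [this] with n hn
    by_cases hc : PowerSeries.coeff n f = 0
    · rw [hc, mul_zero]; positivity
    · exact hn (h.supp n hc)
  obtain ⟨C, hC⟩ := (isBoundedUnder_of_eventually_le h1).bddAbove_range
  have hC' : ∀ n, threeHalves n * PowerSeries.coeff n f ≤ C := fun n => hC ⟨n, rfl⟩
  exact ⟨C, (mul_nonneg (threeHalves_nonneg 0) (h.nonneg 0)).trans (hC' 0), hC'⟩

/-- Half of a convolution: the terms `fᵢ gₙ₋ᵢ` with `i` at most `n / 2` (as selected by `P n`)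
contribute `d · ∑ fᵢ` to the limit, by dominated convergence. -/
theorem CoeffAsymp.tendsto_half_conv {Q r s : ℕ} {f g : PowerSeries ℝ} {c S d T : ℝ}
    (hf : CoeffAsymp Q r f c S) (hg : CoeffAsymp Q s g d T)
    (P : ℕ → ℕ → Prop) [∀ n i, Decidable (P n i)] (hP : ∀ n i, P n i → 2 * i ≤ n)
    (hP' : ∀ i, ∀ᶠ n in atTop, P n i) :
    Tendsto (fun n => ∑' i, if P n i then PowerSeries.coeff i f *
        (threeHalves n * PowerSeries.coeff (n - i) g) else 0)
      (atTop ⊓ 𝓟 {n | n ≡ r + s [MOD Q]}) (𝓝 (d * S)) := by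
  obtain ⟨C, hC0, hC⟩ := hg.exists_bound
  have hlim : d * S = ∑' i, PowerSeries.coeff i f * d := by
    rw [tsum_mul_right, hf.hasSum.tsum_eq, mul_comm]
  rw [hlim]
  refine tendsto_tsum_of_dominated_convergence
    (bound := fun i => PowerSeries.coeff i f * (threeHalves 2 * C))
    (hf.hasSum.summable.mul_right _) (fun i => ?_) (Eventually.of_forall fun n i => ?_)
  · by_cases hi : PowerSeries.coeff i f = 0
    · simpa [hi] using tendsto_const_nhds
    have hir := hf.supp i hi
    have hshift : Tendsto (fun n => n - i) (atTop ⊓ 𝓟 {n | n ≡ r + s [MOD Q]})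
        (atTop ⊓ 𝓟 {n | n ≡ s [MOD Q]}) := by
      refine tendsto_inf.2 ⟨(tendsto_sub_atTop_nat i).mono_left inf_le_left, ?_⟩
      rw [tendsto_principal, eventually_inf_principal]
      filter_upwards [eventually_ge_atTop i] with n hn hmod
      refine Nat.ModEq.add_left_cancel hir ?_
      rw [Nat.add_sub_cancel' hn]
      exact hmod
    have h1 := ((tendsto_threeHalves_div i).mono_left
      (inf_le_left (b := 𝓟 {n | n ≡ r + s [MOD Q]}))).mul (hg.tendsto.comp hshift)
    rw [one_mul] at h1
    refine (h1.const_mul (PowerSeries.coeff i f)).congr' ?_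
    filter_upwards [(hP' i).filter_mono inf_le_left,
      (eventually_gt_atTop i).filter_mono inf_le_left] with n hn hin
    rw [if_pos hn]
    have := (threeHalves_pos (Nat.sub_pos_of_lt hin)).ne'
    simp only [Function.comp]
    field_simp
  · have hfi := hf.nonneg i
    split_ifs with h
    · have hgi := hg.nonneg (n - i)
      rw [Real.norm_of_nonneg (by have := threeHalves_nonneg n; positivity)]
      refine mul_le_mul_of_nonneg_left ?_ hfi
      calc threeHalves n * PowerSeries.coeff (n - i) g
          ≤ threeHalves (2 * (n - i)) * PowerSeries.coeff (n - i) g := by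
            refine mul_le_mul_of_nonneg_right (threeHalves_mono ?_) hgi
            have := hP n i h
            omega
        _ = threeHalves 2 * (threeHalves (n - i) * PowerSeries.coeff (n - i) g) := by
            rw [threeHalves_mul, mul_assoc]
        _ ≤ _ := mul_le_mul_of_nonneg_left (hC _) (threeHalves_nonneg 2)
    · rw [norm_zero]
      exact mul_nonneg hfi (mul_nonneg (threeHalves_nonneg 2) hC0)

theorem CoeffAsymp.mul {Q r s : ℕ} {f g : PowerSeries ℝ} {c S d T : ℝ}
    (hf : CoeffAsymp Q r f c S) (hg : CoeffAsymp Q s g d T) :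
    CoeffAsymp Q (r + s) (f * g) (c * T + d * S) (S * T) where
  nonneg := coeff_mul_nonneg hf.nonneg hg.nonneg
  supp := hf.supp.mul hg.supp
  hasSum := hasSum_coeff_mul hf.hasSum hg.hasSum
  tendsto := by
    have h1 := hf.tendsto_half_conv hg (fun n i => 2 * i ≤ n) (fun _ _ h => h)
      (fun i => eventually_ge_atTop (2 * i))
    have h2 := hg.tendsto_half_conv hf (fun n i => 2 * i < n) (fun _ _ h => h.le)
      (fun i => eventually_gt_atTop (2 * i))
    rw [add_comm s r] at h2
    have h3 := h2.add h1
    refine h3.congr fun n => ?_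
    have e1 : ∀ (P : ℕ → Prop) [DecidablePred P] (a : ℕ → ℝ), (∀ i, P i → 2 * i ≤ n) →
        (∑' i, if P i then a i else 0) =
          ∑ i ∈ Finset.range n.succ, if P i then a i else 0 := by
      intro P _ a hP
      refine tsum_eq_sum fun i hi => if_neg fun h => hi ?_
      have := hP i h
      rw [Finset.mem_range]; omega
    rw [e1 _ _ fun i h => h.le, e1 _ _ fun i h => h, PowerSeries.coeff_mul,
      Finset.Nat.sum_antidiagonal_eq_sum_range_succ
        (fun i j => PowerSeries.coeff i f * PowerSeries.coeff j g),
      ← Finset.sum_range_reflect, ← Finset.sum_add_distrib, Finset.mul_sum]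
    refine Finset.sum_congr rfl fun i hi => ?_
    have hi' : i ≤ n := Nat.lt_succ_iff.1 (Finset.mem_range.1 hi)
    have e2 : n.succ - 1 - i = n - i := by omega
    have e3 : n - (n - i) = i := by omega
    rw [e2, e3]
    by_cases h : 2 * i ≤ n
    · rw [if_pos h, if_neg (by omega)]; ring
    · rw [if_neg h, if_pos (by omega)]; ring

theorem CoeffAsymp.one (Q : ℕ) : CoeffAsymp Q 0 1 0 1 where
  nonneg := coeff_one_nonneg
  supp := SuppMod.one Q
  hasSum := by
    have := hasSum_ite_eq (0 : ℕ) (1 : ℝ)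
    simpa only [PowerSeries.coeff_one] using this
  tendsto := by
    refine Tendsto.congr' ?_ tendsto_const_nhds
    filter_upwards [(eventually_gt_atTop 0).filter_mono inf_le_left] with n hn
    rw [PowerSeries.coeff_one, if_neg hn.ne', mul_zero]

theorem CoeffAsymp.pow {Q r : ℕ} {f : PowerSeries ℝ} {c S : ℝ}
    (hf : CoeffAsymp Q r f c S) (j : ℕ) :
    CoeffAsymp Q (j * r) (f ^ j) (j * S ^ (j - 1) * c) (S ^ j) := by
  induction j with
  | zero => simpa using CoeffAsymp.one Q
  | succ j ih =>
    have h := ih.mul hf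
    rw [pow_succ, pow_succ, Nat.succ_mul]
    convert h using 1
    rcases j with _ | j
    · simp
    · simp only [Nat.add_sub_cancel]; push_cast; ring

/-- In a product of `j` factors with total degree `n` one factor has degree at least `n / j`;
hence a bound polynomial in `j` times `s ^ j` for the coefficients of `f ^ j`. -/
theorem CoeffAsymp.pow_bound {Q r : ℕ} {f : PowerSeries ℝ} {c S s C : ℝ}
    (hf : CoeffAsymp Q r f c S) (hs : 0 < s) (hSs : S ≤ s)
    (hC : ∀ n, threeHalves n * PowerSeries.coeff n f ≤ C) (j n : ℕ) :
    threeHalves n * PowerSeries.coeff n (f ^ (j + 1)) ≤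
      C * (j + 1) * threeHalves (j + 1) * s ^ j := by
  have hC0 : 0 ≤ C := (mul_nonneg (threeHalves_nonneg 0) (hf.nonneg 0)).trans (hC 0)
  induction j generalizing n with
  | zero => simpa [threeHalves] using hC n
  | succ j ih =>
    set J := j + 1 with hJ
    have hJ0 : 0 < threeHalves J := threeHalves_pos (by omega)
    set D := C * (j + 1) * threeHalves J * s ^ j with hD
    have hD0 : 0 ≤ D := by positivity
    have hfJ := hf.pow J
    have hSJ : S ^ J ≤ s ^ J :=
      pow_le_pow_left₀ (hf.hasSum.nonneg fun n => hf.nonneg n) hSs J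
    -- each term of the convolution is bounded according to which factor has large degree
    have hterm : ∀ kl ∈ Finset.HasAntidiagonal.antidiagonal n,
        threeHalves J * threeHalves n *
          (PowerSeries.coeff kl.1 (f ^ J) * PowerSeries.coeff kl.2 f) ≤
        threeHalves J * threeHalves (J + 1) * C * PowerSeries.coeff kl.1 (f ^ J) +
          threeHalves (J + 1) * D * PowerSeries.coeff kl.2 f := by
      rintro ⟨k, l⟩ hkl
      have hkl' : k + l = n := Finset.HasAntidiagonal.mem_antidiagonal.1 hkl
      have ha := hfJ.nonneg k
      have hb := hf.nonneg l
      have hJ1 := threeHalves_nonneg (J + 1)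
      simp only
      by_cases hl : n ≤ (J + 1) * l
      · have h1 : threeHalves n ≤ threeHalves (J + 1) * threeHalves l := by
          rw [← threeHalves_mul]; exact threeHalves_mono hl
        calc _ ≤ threeHalves J * (threeHalves (J + 1) * threeHalves l) *
              (PowerSeries.coeff k (f ^ J) * PowerSeries.coeff l f) := by gcongr
          _ = threeHalves J * threeHalves (J + 1) * (threeHalves l * PowerSeries.coeff l f) *
              PowerSeries.coeff k (f ^ J) := by ring
          _ ≤ threeHalves J * threeHalves (J + 1) * C * PowerSeries.coeff k (f ^ J) := by
              gcongr; exact hC l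
          _ ≤ _ := le_add_of_nonneg_right (by positivity)
      · have h1 : threeHalves J * threeHalves n ≤ threeHalves (J + 1) * threeHalves k := by
          rw [← threeHalves_mul, ← threeHalves_mul]
          refine threeHalves_mono ?_
          subst hkl'
          push Not at hl
          nlinarith
        calc _ ≤ threeHalves (J + 1) * threeHalves k *
              (PowerSeries.coeff k (f ^ J) * PowerSeries.coeff l f) := by gcongr
          _ = threeHalves (J + 1) * (threeHalves k * PowerSeries.coeff k (f ^ J)) *
              PowerSeries.coeff l f := by ring
          _ ≤ threeHalves (J + 1) * D * PowerSeries.coeff l f := by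
              gcongr; exact ih k
          _ ≤ _ := le_add_of_nonneg_left (by positivity)
    have hsum1 : ∑ kl ∈ Finset.HasAntidiagonal.antidiagonal n,
        PowerSeries.coeff kl.1 (f ^ J) ≤ s ^ J := by
      rw [Finset.Nat.sum_antidiagonal_eq_sum_range_succ_mk]
      exact (sum_le_hasSum _ (fun i _ => hfJ.nonneg i) hfJ.hasSum).trans hSJ
    have hsum2 : ∑ kl ∈ Finset.HasAntidiagonal.antidiagonal n, PowerSeries.coeff kl.2 f ≤ s := by
      rw [← Finset.Nat.sum_antidiagonal_swap]
      simp only [Prod.snd_swap]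
      rw [Finset.Nat.sum_antidiagonal_eq_sum_range_succ_mk]
      exact (sum_le_hasSum _ (fun i _ => hf.nonneg i) hf.hasSum).trans hSs
    have htot : threeHalves J * threeHalves n * PowerSeries.coeff n (f ^ (J + 1)) ≤
        threeHalves J * threeHalves (J + 1) * C * s ^ J + threeHalves (J + 1) * D * s := by
      rw [pow_succ, PowerSeries.coeff_mul, Finset.mul_sum]
      refine (Finset.sum_le_sum hterm).trans ?_
      rw [Finset.sum_add_distrib, ← Finset.mul_sum, ← Finset.mul_sum]
      have hJ1 := threeHalves_nonneg (J + 1)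
      gcongr
    refine le_of_mul_le_mul_left ?_ hJ0
    calc _ = threeHalves J * threeHalves n * PowerSeries.coeff n (f ^ (J + 1)) := by ring
      _ ≤ _ := htot
      _ = _ := by rw [hD, hJ]; push_cast; ring

/-- The coefficients of `ψ(f)` as sums in `ℝ`; only finitely many terms are nonzero because `f` has
no constant term. -/
theorem hasSum_coeff_subst {f : PowerSeries ℝ} (hf : PowerSeries.coeff 0 f = 0)
    (ψ : PowerSeries ℝ) (n : ℕ) :
    HasSum (fun j => PowerSeries.coeff j ψ * PowerSeries.coeff n (f ^ j))
      (PowerSeries.coeff n (PowerSeries.subst f ψ)) := by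
  have hs : PowerSeries.HasSubst f :=
    PowerSeries.HasSubst.of_constantCoeff_zero' (by simpa using hf)
  have hfin := PowerSeries.coeff_subst_finite' hs ψ n
  rw [PowerSeries.coeff_subst' hs]
  simp only [smul_eq_mul] at hfin ⊢
  rw [← tsum_eq_finsum (L := SummationFilter.unconditional ℕ) hfin]
  exact (summable_of_hasFiniteSupport hfin).hasSum

/-- A composition of series with nonnegative coefficients is evaluated at `1` termwise. -/
theorem hasSum_coeff_subst_value {f ψ : PowerSeries ℝ} {S : ℝ}
    (hf : ∀ n, 0 ≤ PowerSeries.coeff n f) (hf0 : PowerSeries.coeff 0 f = 0)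
    (hS : HasSum (fun n => PowerSeries.coeff n f) S)
    (hψ : ∀ n, 0 ≤ PowerSeries.coeff n ψ)
    (hψS : Summable fun j => PowerSeries.coeff j ψ * S ^ j) :
    HasSum (fun n => PowerSeries.coeff n (PowerSeries.subst f ψ)) (value ψ S) := by
  have hpow : ∀ j, HasSum (fun n => PowerSeries.coeff n (f ^ j)) (S ^ j) := by
    intro j
    induction j with
    | zero => simpa only [pow_zero, PowerSeries.coeff_one] using hasSum_ite_eq (0 : ℕ) (1 : ℝ)
    | succ j ih => rw [pow_succ, pow_succ]; exact hasSum_coeff_mul ih hS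
  have h3 : ∀ j, HasSum (fun n => PowerSeries.coeff j ψ * PowerSeries.coeff n (f ^ j))
      (PowerSeries.coeff j ψ * S ^ j) := fun j => (hpow j).mul_left _
  have hsum : Summable fun p : ℕ × ℕ =>
      PowerSeries.coeff p.1 ψ * PowerSeries.coeff p.2 (f ^ p.1) := by
    rw [summable_prod_of_nonneg fun p =>
      mul_nonneg (hψ p.1) (coeff_pow_nonneg hf p.1 p.2)]
    refine ⟨fun j => (h3 j).summable, ?_⟩
    simp_rw [fun j => (h3 j).tsum_eq]
    exact hψS
  have h4 := hsum.hasSum.prod_fiberwise h3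
  have h5 := (Equiv.prodComm ℕ ℕ).hasSum_iff.2 hsum.hasSum
  have h6 := h5.prod_fiberwise (fun n => hasSum_coeff_subst hf0 ψ n)
  rw [← h4.tsum_eq] at h6
  simpa [value] using h6

theorem summable_coeff_mul_natPow {ψ : PowerSeries ℝ} {s r : ℝ} (hs : 0 < s) (hsr : s < r)
    (hψ0 : ∀ n, 0 ≤ PowerSeries.coeff n ψ)
    (hr : Summable fun j => PowerSeries.coeff j ψ * r ^ j) (k : ℕ) :
    Summable fun j : ℕ => (j : ℝ) ^ k * (PowerSeries.coeff j ψ * s ^ j) := by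
  have hr0 : 0 < r := hs.trans hsr
  have h1 : Tendsto (fun j : ℕ => (j : ℝ) ^ k * (s / r) ^ j) atTop (𝓝 0) :=
    tendsto_pow_const_mul_const_pow_of_abs_lt_one k (by
      rw [abs_of_pos (by positivity), div_lt_one hr0]; exact hsr)
  obtain ⟨C, hC⟩ := h1.bddAbove_range
  refine Summable.of_nonneg_of_le (fun j => ?_) (fun j => ?_) (hr.mul_left C)
  · have := hψ0 j; positivity
  · have h2 : (j : ℝ) ^ k * (s / r) ^ j ≤ C := hC ⟨j, rfl⟩
    have h3 := hψ0 j
    calc _ = ((j : ℝ) ^ k * (s / r) ^ j) * (PowerSeries.coeff j ψ * r ^ j) := by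
          rw [div_pow]; field_simp
      _ ≤ _ := by gcongr

/-- Composition with a power series `ψ` that converges beyond the sum `S` of the coefficients
of `f`: the limit constant is multiplied by `ψ'(S)`. -/
theorem CoeffAsymp.subst {Q : ℕ} {f ψ : PowerSeries ℝ} {c S s r : ℝ}
    (hf : CoeffAsymp Q 1 f c S) (hf0 : PowerSeries.coeff 0 f = 0)
    (hs : 0 < s) (hSs : S ≤ s) (hsr : s < r)
    (hψ0 : ∀ n, 0 ≤ PowerSeries.coeff n ψ) (hψQ : SuppMod Q 0 ψ)
    (hr : Summable fun j => PowerSeries.coeff j ψ * r ^ j) :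
    CoeffAsymp Q 0 (PowerSeries.subst f ψ)
      ((∑' j : ℕ, PowerSeries.coeff j ψ * (j * S ^ (j - 1))) * c) (value ψ S) where
  nonneg n := (hasSum_coeff_subst hf0 ψ n).nonneg fun j =>
    mul_nonneg (hψ0 j) (coeff_pow_nonneg hf.nonneg j n)
  supp n hn := by
    have h := hasSum_coeff_subst hf0 ψ n
    by_contra hmod
    refine hn (h.unique ?_)
    convert hasSum_zero with j
    by_contra hj
    refine hmod ((hf.supp.pow j n (right_ne_zero_of_mul hj)).trans ?_)
    rw [mul_one]
    exact hψQ j (left_ne_zero_of_mul hj)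
  hasSum := by
    have hS0 : 0 ≤ S := hf.hasSum.nonneg hf.nonneg
    refine hasSum_coeff_subst_value hf.nonneg hf0 hf.hasSum hψ0 ?_
    refine Summable.of_nonneg_of_le (fun j => mul_nonneg (hψ0 j) (pow_nonneg hS0 j))
      (fun j => ?_) hr
    exact mul_le_mul_of_nonneg_left (pow_le_pow_left₀ hS0 (hSs.trans hsr.le) j) (hψ0 j)
  tendsto := by
    obtain ⟨C, hC0, hC⟩ := hf.exists_bound
    rw [← tsum_mul_right]
    have hn : ∀ n, threeHalves n * PowerSeries.coeff n (PowerSeries.subst f ψ) =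
        ∑' j, PowerSeries.coeff j ψ * (threeHalves n * PowerSeries.coeff n (f ^ j)) := by
      intro n
      rw [← (hasSum_coeff_subst hf0 ψ n).tsum_eq, ← tsum_mul_left]
      exact tsum_congr fun j => by ring
    simp_rw [hn]
    refine tendsto_tsum_of_dominated_convergence
      (bound := fun j : ℕ => C / s * ((j : ℝ) ^ 3 * (PowerSeries.coeff j ψ * s ^ j)))
      ((summable_coeff_mul_natPow hs hsr hψ0 hr 3).mul_left _) (fun j => ?_)
      (Eventually.of_forall fun n j => ?_)
    · by_cases hj : PowerSeries.coeff j ψ = 0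
      · simpa [hj] using tendsto_const_nhds
      have h1 : j * 1 ≡ 0 [MOD Q] := by rw [mul_one]; exact hψQ j hj
      have h2 := (hf.pow j).tendsto
      have h3 : {n | n ≡ j * 1 [MOD Q]} = {n | n ≡ 0 [MOD Q]} :=
        Set.ext fun n => ⟨fun h => h.trans h1, fun h => h.trans h1.symm⟩
      rw [h3] at h2
      rw [mul_assoc]
      exact h2.const_mul _
    · have h1 := hψ0 j
      have h2 := coeff_pow_nonneg hf.nonneg j n
      have h3 := threeHalves_nonneg n
      rw [Real.norm_of_nonneg (by positivity)]
      rcases j with _ | j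
      · rw [pow_zero, PowerSeries.coeff_one]
        split_ifs with h
        · simp [h, threeHalves]
        · simp
      · have h4 := hf.pow_bound hs hSs hC j n
        have h5 := threeHalves_le_sq (j + 1)
        push_cast at h5 ⊢
        calc _ ≤ PowerSeries.coeff (j + 1) ψ * (C * (j + 1) * (j + 1) ^ 2 * s ^ j) := by
              refine mul_le_mul_of_nonneg_left (h4.trans ?_) h1
              gcongr
          _ = _ := by rw [pow_succ s j]; field_simp

/-! ### Lagrange inversion -/

theorem coeff_pow_eq_zero_of_lt {g : PowerSeries ℝ} (hg : PowerSeries.coeff 0 g = 0) {j n : ℕ}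
    (h : n < j) : PowerSeries.coeff n (g ^ j) = 0 := by
  obtain ⟨q, rfl⟩ := PowerSeries.X_dvd_iff.2 (by simpa using hg)
  rw [mul_pow, PowerSeries.coeff_X_pow_mul', if_neg (by omega)]

/-- Lagrange inversion for the powers of `g`. The proof is by strong induction on `n`: comparing
coefficients in `g ^ k = X ^ k ψ(g) ^ k` gives the coefficient of `g ^ k` of order `n` through those
of order `n - k` of all the powers `g ^ j`. -/
theorem IsLagrangeSolution.coeff_pow {ψ g : PowerSeries ℝ} (hg : IsLagrangeSolution ψ g) (n : ℕ) :
    ∀ k, k ≤ n → (n : ℝ) * PowerSeries.coeff n (g ^ k) =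
      k * PowerSeries.coeff (n - k) (ψ ^ n) := by
  induction n using Nat.strong_induction_on with
  | _ n ih =>
  intro k hk
  rcases Nat.eq_zero_or_pos k with rfl | hk0
  · rcases Nat.eq_zero_or_pos n with rfl | hn
    · simp
    · simp [PowerSeries.coeff_one, hn.ne']
  obtain ⟨m, rfl⟩ := Nat.exists_eq_add_of_le hk
  have hs : PowerSeries.HasSubst g :=
    PowerSeries.HasSubst.of_constantCoeff_zero' (by simpa using hg.coeff_zero)
  have hgk : g ^ k = PowerSeries.X ^ k * PowerSeries.subst g (ψ ^ k) := by
    conv_lhs => rw [hg.equation]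
    rw [mul_pow, PowerSeries.subst_pow hs]
  have hcoeff : PowerSeries.coeff (k + m) (g ^ k) =
      ∑ j ∈ Finset.range (m + 1), PowerSeries.coeff j (ψ ^ k) * PowerSeries.coeff m (g ^ j) := by
    rw [hgk, PowerSeries.coeff_X_pow_mul', if_pos (by omega), Nat.add_sub_cancel_left]
    refine (hasSum_coeff_subst hg.coeff_zero (ψ ^ k) m).unique (hasSum_sum_of_ne_finset_zero ?_)
    intro j hj
    rw [coeff_pow_eq_zero_of_lt hg.coeff_zero (by simpa using hj), mul_zero]
  rw [Nat.add_sub_cancel_left]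
  rcases Nat.eq_zero_or_pos m with rfl | hm
  · rw [hcoeff]; simp
  have hm' : (m : ℝ) ≠ 0 := by exact_mod_cast hm.ne'
  -- the Euler operator `X d/dX` turns the recursion into an identity between derivatives
  have hX : ∀ f : PowerSeries ℝ, ∀ i,
      PowerSeries.coeff i (PowerSeries.X * PowerSeries.derivative ℝ f) =
        i * PowerSeries.coeff i f := by
    intro f i
    rcases i with _ | i
    · simp
    · rw [PowerSeries.coeff_succ_X_mul, PowerSeries.coeff_derivative]; push_cast; ring
  have h1 : (m : ℝ) * PowerSeries.coeff (k + m) (g ^ k) =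
      PowerSeries.coeff m ((PowerSeries.X * PowerSeries.derivative ℝ (ψ ^ k)) * ψ ^ m) := by
    rw [hcoeff, PowerSeries.coeff_mul, Finset.mul_sum,
      Finset.Nat.sum_antidiagonal_eq_sum_range_succ (fun i j =>
        PowerSeries.coeff i (PowerSeries.X * PowerSeries.derivative ℝ (ψ ^ k)) *
          PowerSeries.coeff j (ψ ^ m))]
    refine Finset.sum_congr rfl fun j hj => ?_
    rw [hX, mul_left_comm, ih m (by omega) j (Nat.lt_succ_iff.1 (Finset.mem_range.1 hj))]
    ring
  have h2 : (k + m : ℕ) • ((PowerSeries.X * PowerSeries.derivative ℝ (ψ ^ k)) * ψ ^ m) =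
      k • (PowerSeries.X * PowerSeries.derivative ℝ (ψ ^ (k + m))) := by
    obtain ⟨k, rfl⟩ := Nat.exists_eq_succ_of_ne_zero hk0.ne'
    rw [Derivation.leibniz_pow, Derivation.leibniz_pow]
    have : k.succ + m - 1 = k + m := by omega
    rw [this, Nat.succ_sub_one, pow_add]
    simp only [nsmul_eq_mul, smul_eq_mul]
    ring
  have h3 := congrArg (PowerSeries.coeff m) h2
  rw [map_nsmul, map_nsmul, ← h1, hX, nsmul_eq_mul, nsmul_eq_mul] at h3
  refine mul_left_cancel₀ hm' ?_
  linear_combination h3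

theorem IsLagrangeSolution.coeff_eq {ψ g : PowerSeries ℝ} (hg : IsLagrangeSolution ψ g) {n : ℕ}
    (hn : 0 < n) : (n : ℝ) * PowerSeries.coeff n g = PowerSeries.coeff (n - 1) (ψ ^ n) := by
  simpa using hg.coeff_pow n 1 hn

theorem IsLagrangeSolution.coeff_nonneg {ψ g : PowerSeries ℝ} (hg : IsLagrangeSolution ψ g)
    (hψ : ∀ n, 0 ≤ PowerSeries.coeff n ψ) (n : ℕ) : 0 ≤ PowerSeries.coeff n g := by
  rcases Nat.eq_zero_or_pos n with rfl | hn
  · exact hg.coeff_zero.ge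
  · have h := hg.coeff_eq hn
    have h1 := coeff_pow_nonneg hψ n (n - 1)
    rw [← h] at h1
    exact nonneg_of_mul_nonneg_right h1 (by exact_mod_cast hn)

theorem IsLagrangeSolution.suppMod {ψ g : PowerSeries ℝ} (hg : IsLagrangeSolution ψ g)
    {Q : ℕ} (hψ : SuppMod Q 0 ψ) : SuppMod Q 1 g := by
  intro n hn
  rcases Nat.eq_zero_or_pos n with rfl | hn0
  · exact absurd hg.coeff_zero hn
  · have h := hg.coeff_eq hn0
    have h1 : PowerSeries.coeff (n - 1) (ψ ^ n) ≠ 0 := by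
      rw [← h]
      exact mul_ne_zero (by exact_mod_cast hn0.ne') hn
    have h2 := (hψ.pow n _ h1).add_right 1
    rwa [Nat.sub_add_cancel hn0, mul_zero, zero_add] at h2

/-! ### The value of the solution at the critical point -/

theorem rescale_subst {f : PowerSeries ℝ} (hf : PowerSeries.coeff 0 f = 0) (ψ : PowerSeries ℝ)
    (ρ : ℝ) : PowerSeries.rescale ρ (PowerSeries.subst f ψ) =
      PowerSeries.subst (PowerSeries.rescale ρ f) ψ := by
  ext n
  have h1 := (hasSum_coeff_subst hf ψ n).mul_left (ρ ^ n)
  have h2 := hasSum_coeff_subst (f := PowerSeries.rescale ρ f)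
    (by rw [PowerSeries.coeff_rescale, hf, mul_zero]) ψ n
  rw [PowerSeries.coeff_rescale]
  refine h1.unique (h2.congr_fun ?_)
  intro j
  rw [← map_pow, PowerSeries.coeff_rescale]
  ring

/-- Truncation is submultiplicative for nonnegative coefficients. -/
theorem sum_range_coeff_pow_le {f : PowerSeries ℝ} (hf : ∀ n, 0 ≤ PowerSeries.coeff n f)
    (N j : ℕ) : ∑ n ∈ Finset.range N, PowerSeries.coeff n (f ^ j) ≤
      (∑ n ∈ Finset.range N, PowerSeries.coeff n f) ^ j := by
  induction j with
  | zero =>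
    simp only [pow_zero, PowerSeries.coeff_one, Finset.sum_ite_eq']
    split_ifs <;> norm_num
  | succ j ih =>
    have hf' := coeff_pow_nonneg hf j
    calc ∑ n ∈ Finset.range N, PowerSeries.coeff n (f ^ (j + 1))
        = ∑ n ∈ Finset.range N, ∑ k ∈ Finset.range (N - n),
            PowerSeries.coeff n (f ^ j) * PowerSeries.coeff k f := by
          rw [← Finset.sum_range_diag_flip N
            (fun n k => PowerSeries.coeff n (f ^ j) * PowerSeries.coeff k f)]
          refine Finset.sum_congr rfl fun n _ => ?_
          rw [pow_succ, PowerSeries.coeff_mul, Finset.Nat.sum_antidiagonal_eq_sum_range_succ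
            (fun n k => PowerSeries.coeff n (f ^ j) * PowerSeries.coeff k f)]
      _ ≤ ∑ n ∈ Finset.range N, ∑ k ∈ Finset.range N,
            PowerSeries.coeff n (f ^ j) * PowerSeries.coeff k f := by
          refine Finset.sum_le_sum fun n _ => Finset.sum_le_sum_of_subset_of_nonneg ?_ ?_
          · exact Finset.range_subset_range.2 (Nat.sub_le N n)
          · exact fun k _ _ => mul_nonneg (hf' n) (hf k)
      _ = (∑ n ∈ Finset.range N, PowerSeries.coeff n (f ^ j)) *
            ∑ n ∈ Finset.range N, PowerSeries.coeff n f := (Finset.sum_mul_sum _ _ _ _).symm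
      _ ≤ _ := by
          rw [pow_succ]
          exact mul_le_mul_of_nonneg_right ih (Finset.sum_nonneg fun n _ => hf n)

/-- Every partial sum of the coefficients of a nonnegative solution of `f = ρ X ψ(f)` is bounded
by a positive fixed point of `t ↦ ρ ψ(t)`. -/
theorem sum_range_coeff_le {f ψ : PowerSeries ℝ} {ρ τ : ℝ} (hρ : 0 ≤ ρ) (hτ : 0 ≤ τ)
    (hf : ∀ n, 0 ≤ PowerSeries.coeff n f) (hf0 : PowerSeries.coeff 0 f = 0)
    (hψ : ∀ n, 0 ≤ PowerSeries.coeff n ψ)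
    (hψτ : HasSum (fun j => PowerSeries.coeff j ψ * τ ^ j) (value ψ τ))
    (hfix : ρ * value ψ τ = τ)
    (heq : ∀ n, PowerSeries.coeff (n + 1) f =
      ρ * PowerSeries.coeff n (PowerSeries.subst f ψ)) (N : ℕ) :
    ∑ n ∈ Finset.range N, PowerSeries.coeff n f ≤ τ := by
  induction N with
  | zero => simpa using hτ
  | succ N ih =>
    rw [Finset.sum_range_succ', hf0, add_zero, Finset.sum_congr rfl fun n _ => heq n,
      ← Finset.mul_sum]
    refine (mul_le_mul_of_nonneg_left ?_ hρ).trans hfix.le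
    refine hasSum_le (fun j => ?_) (hasSum_sum fun n _ => hasSum_coeff_subst hf0 ψ n) hψτ
    rw [← Finset.mul_sum]
    refine mul_le_mul_of_nonneg_left ?_ (hψ j)
    exact (sum_range_coeff_pow_le hf N j).trans
      (pow_le_pow_left₀ (Finset.sum_nonneg fun n _ => hf n) ih j)

/-- The generating function of a probability law of mean `1` with an atom at `0` has no fixed
point in `[0, ∞)` other than `1`: this is strict convexity, in the form
`x ^ j - 1 - j (x - 1) ≥ (j - 1) (x - 1) ^ 2`. -/
theorem eq_one_of_fixed_point {p : ℕ → ℝ} {x : ℝ} (hp : ∀ j, 0 ≤ p j) (hp0 : 0 < p 0)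
    (h1 : HasSum p 1) (hm : HasSum (fun j => j * p j) 1) (hx : 0 ≤ x)
    (hfix : HasSum (fun j => p j * x ^ j) x) : x = 1 := by
  have key : ∀ j : ℕ, ((j : ℝ) - 1) * (x - 1) ^ 2 ≤ x ^ j - 1 - j * (x - 1) := by
    intro j
    rcases j with _ | j
    · simp; positivity
    have hB : 1 + (j : ℝ) * (x - 1) ≤ (1 + (x - 1)) ^ j :=
      one_add_mul_le_pow (by linarith) j
    rw [add_sub_cancel] at hB
    rw [pow_succ x j]
    push_cast
    nlinarith [mul_le_mul_of_nonneg_right hB hx]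
  have hsum : HasSum (fun j : ℕ =>
      p j * (x ^ j - 1 - j * (x - 1) - ((j : ℝ) - 1) * (x - 1) ^ 2)) 0 := by
    have h := ((hfix.sub h1).sub (hm.mul_right (x - 1))).sub ((hm.sub h1).mul_right ((x - 1) ^ 2))
    have e : x - 1 - 1 * (x - 1) - (1 - 1) * (x - 1) ^ 2 = 0 := by ring
    rw [e] at h
    exact h.congr_fun fun j => by ring
  -- the term of index `0` is `p 0 * (x - 1) ^ 2`
  have h0 := le_hasSum hsum 0 fun j _ => mul_nonneg (hp j) (sub_nonneg.2 (key j))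
  simp only [pow_zero, CharP.cast_eq_zero] at h0
  have h2 : (x - 1) ^ 2 ≤ 0 := by
    by_contra h
    push Not at h
    nlinarith [mul_pos hp0 h]
  nlinarith [pow_eq_zero_iff (n := 2) (by norm_num) |>.1 (le_antisymm h2 (sq_nonneg (x - 1)))]

/-! ### A local limit theorem on the lattice of the period -/

/-- `P` is the generating function of a law on `ℕ` with an atom at `0`, mean `1` and finite third
moment, and `Q` is the greatest common divisor of its support. -/
structure CriticalLaw (Q : ℕ) (P : PowerSeries ℝ) : Prop where
  nonneg : ∀ n, 0 ≤ PowerSeries.coeff n P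
  zero_pos : 0 < PowerSeries.coeff 0 P
  hasSum : HasSum (fun n => PowerSeries.coeff n P) 1
  mean : HasSum (fun n : ℕ => n * PowerSeries.coeff n P) 1
  moment : Summable fun n : ℕ => (n : ℝ) ^ 3 * PowerSeries.coeff n P
  period_pos : 0 < Q
  supp : SuppMod Q 0 P
  dvd_period : ∀ d, SuppMod d 0 P → d ∣ Q

/-- The characteristic function of `X - 1`, where `X` has generating function `P`. -/
noncomputable def centredCharFun (P : PowerSeries ℝ) (θ : ℝ) : ℂ :=
  ∑' j : ℕ, ((PowerSeries.coeff j P : ℝ) : ℂ) *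
    Complex.exp (((((j : ℝ) - 1) * θ : ℝ) : ℂ) * Complex.I)

theorem norm_exp_sub_taylor_two_le (x : ℝ) :
    ‖Complex.exp (x * Complex.I) - (1 + x * Complex.I - x ^ 2 / 2)‖ ≤ 4 * |x| ^ 3 := by
  have hn : ‖(x : ℂ) * Complex.I‖ = |x| := by simp
  rcases le_total |x| 1 with h | h
  · have := Complex.exp_bound (x := x * Complex.I) (by rwa [hn]) (n := 3) (by norm_num)
    rw [hn] at this
    have e : ∑ m ∈ Finset.range 3, ((x : ℂ) * Complex.I) ^ m / (m.factorial : ℂ) =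
        1 + x * Complex.I - x ^ 2 / 2 := by
      simp [Finset.sum_range_succ, Nat.factorial, mul_pow]
      ring
    rw [e] at this
    refine this.trans ?_
    rw [mul_comm]
    refine mul_le_mul_of_nonneg_right ?_ (by positivity)
    norm_num [Nat.factorial]
  · have h1 : ‖Complex.exp (x * Complex.I)‖ = 1 := Complex.norm_exp_ofReal_mul_I x
    have h2 : ‖(1 + x * Complex.I - x ^ 2 / 2 : ℂ)‖ ≤ 1 + |x| + |x| ^ 2 / 2 := by
      refine (norm_sub_le _ _).trans (add_le_add ((norm_add_le _ _).trans ?_) ?_)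
      · simp
      · simp
    refine (norm_sub_le _ _).trans ?_
    rw [h1]
    nlinarith [mul_nonneg (sub_nonneg.2 h) (abs_nonneg x),
      mul_nonneg (sub_nonneg.2 h) (sq_nonneg |x|)]

namespace CriticalLaw

variable {Q : ℕ} {P : PowerSeries ℝ}

theorem norm_term (hP : CriticalLaw Q P) (j : ℕ) (θ : ℝ) :
    ‖((PowerSeries.coeff j P : ℝ) : ℂ) * Complex.exp (((((j : ℝ) - 1) * θ : ℝ) : ℂ) * Complex.I)‖ =
      PowerSeries.coeff j P := by
  rw [norm_mul, Complex.norm_exp_ofReal_mul_I, mul_one, Complex.norm_real,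
    Real.norm_of_nonneg (hP.nonneg j)]

theorem summable_term (hP : CriticalLaw Q P) (θ : ℝ) : Summable fun j : ℕ =>
    ((PowerSeries.coeff j P : ℝ) : ℂ) * Complex.exp (((((j : ℝ) - 1) * θ : ℝ) : ℂ) * Complex.I) :=
  Summable.of_norm (by simpa only [hP.norm_term] using hP.hasSum.summable)

theorem continuous_centredCharFun (hP : CriticalLaw Q P) : Continuous (centredCharFun P) := by
  refine continuous_tsum (fun j => ?_) hP.hasSum.summable fun j θ => (hP.norm_term j θ).le
  fun_prop

theorem norm_centredCharFun_le_one (hP : CriticalLaw Q P) (θ : ℝ) : ‖centredCharFun P θ‖ ≤ 1 :=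
  tsum_of_norm_bounded hP.hasSum fun j => (hP.norm_term j θ).le

theorem summable_sq (hP : CriticalLaw Q P) :
    Summable fun n : ℕ => ((n : ℝ) - 1) ^ 2 * PowerSeries.coeff n P := by
  refine Summable.of_nonneg_of_le (fun n => mul_nonneg (sq_nonneg _) (hP.nonneg n)) (fun n => ?_)
    (hP.moment.add hP.hasSum.summable)
  have h0 := hP.nonneg n
  rcases n with _ | n
  · simp
  · push_cast
    have : ((n : ℝ) + 1 - 1) ^ 2 ≤ ((n : ℝ) + 1) ^ 3 := by
      have : (0 : ℝ) ≤ n := n.cast_nonneg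
      nlinarith [mul_nonneg this this, mul_nonneg (mul_nonneg this this) this]
    nlinarith [mul_le_mul_of_nonneg_right this h0]

theorem summable_cube (hP : CriticalLaw Q P) :
    Summable fun n : ℕ => |(n : ℝ) - 1| ^ 3 * PowerSeries.coeff n P := by
  refine Summable.of_nonneg_of_le (fun n => mul_nonneg (by positivity) (hP.nonneg n)) (fun n => ?_)
    (hP.moment.add hP.hasSum.summable)
  have h0 := hP.nonneg n
  rcases n with _ | n
  · simp
  · push_cast
    have h1 : (0 : ℝ) ≤ n := n.cast_nonneg
    rw [add_sub_cancel_right, abs_of_nonneg h1]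
    have : (n : ℝ) ^ 3 ≤ ((n : ℝ) + 1) ^ 3 := by gcongr; linarith
    nlinarith [mul_le_mul_of_nonneg_right this h0]

/-- The variance of the law. -/
theorem exists_variance (hP : CriticalLaw Q P) : ∃ v, 0 < v ∧
    HasSum (fun n : ℕ => ((n : ℝ) - 1) ^ 2 * PowerSeries.coeff n P) v := by
  refine ⟨_, ?_, hP.summable_sq.hasSum⟩
  refine hP.summable_sq.tsum_pos (fun n => mul_nonneg (sq_nonneg _) (hP.nonneg n)) 0 ?_
  simpa using hP.zero_pos

/-- Second order expansion at the origin; the linear term vanishes since the mean is `1`. -/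
theorem exists_taylor (hP : CriticalLaw Q P) : ∃ v M, 0 < v ∧ 0 ≤ M ∧
    ∀ θ : ℝ, ‖centredCharFun P θ - (1 - (v * θ ^ 2 / 2 : ℝ))‖ ≤ M * |θ| ^ 3 := by
  obtain ⟨v, hv, hvs⟩ := hP.exists_variance
  refine ⟨v, 4 * ∑' n : ℕ, |(n : ℝ) - 1| ^ 3 * PowerSeries.coeff n P, hv,
    mul_nonneg (by norm_num) (tsum_nonneg fun n => mul_nonneg (by positivity) (hP.nonneg n)),
    fun θ => ?_⟩
  have hc : HasSum (fun n : ℕ => ((n : ℝ) - 1) * PowerSeries.coeff n P) 0 := by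
    have h := hP.mean.sub hP.hasSum
    rw [sub_self] at h
    exact h.congr_fun fun n => by ring
  have h1 : HasSum (fun j : ℕ => ((PowerSeries.coeff j P : ℝ) : ℂ) *
      (1 + ((((j : ℝ) - 1) * θ : ℝ) : ℂ) * Complex.I - ((((j : ℝ) - 1) * θ : ℝ) : ℂ) ^ 2 / 2))
      (1 - ((v * θ ^ 2 / 2 : ℝ) : ℂ)) := by
    have a1 := Complex.hasSum_ofReal.2 hP.hasSum
    have a2 := ((Complex.hasSum_ofReal.2 hc).mul_right (θ : ℂ)).mul_right Complex.I
    have a3 := Complex.hasSum_ofReal.2 (hvs.mul_right (θ ^ 2 / 2))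
    have a4 := (a1.add a2).sub a3
    have e : ((1 : ℝ) : ℂ) + ((0 : ℝ) : ℂ) * θ * Complex.I - ((v * (θ ^ 2 / 2) : ℝ) : ℂ) =
        1 - ((v * θ ^ 2 / 2 : ℝ) : ℂ) := by push_cast; ring
    rw [e] at a4
    exact a4.congr_fun fun j => by push_cast; ring
  have h2 := (hP.summable_term θ).hasSum.sub h1
  change HasSum _ (centredCharFun P θ - _) at h2
  rw [← h2.tsum_eq]
  have h3 := ((hP.summable_cube.hasSum.mul_left 4).mul_right (|θ| ^ 3))
  refine tsum_of_norm_bounded h3 fun j => ?_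
  rw [← mul_sub, norm_mul, Complex.norm_real, Real.norm_of_nonneg (hP.nonneg j)]
  refine (mul_le_mul_of_nonneg_left (norm_exp_sub_taylor_two_le _) (hP.nonneg j)).trans_eq ?_
  rw [abs_mul]
  ring

/-- The Fourier series of `centredCharFun P θ ^ n`, shifted to be centred at `m`. -/
theorem hasSum_exp_mul_pow (hP : CriticalLaw Q P) (n m : ℕ) (θ : ℝ) :
    HasSum (fun j : ℕ => ((PowerSeries.coeff j (P ^ n) : ℝ) : ℂ) *
      Complex.exp (((((j : ℝ) - m) * θ : ℝ) : ℂ) * Complex.I))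
      (Complex.exp ((((n : ℝ) - m) * θ : ℝ) * Complex.I) * centredCharFun P θ ^ n) := by
  set z : ℂ := Complex.exp (θ * Complex.I) with hz
  have hz1 : ‖z‖ = 1 := Complex.norm_exp_ofReal_mul_I θ
  have hzp : ∀ j : ℕ, z ^ j = Complex.exp ((j * θ : ℝ) * Complex.I) := by
    intro j
    rw [hz, ← Complex.exp_nat_mul]
    congr 1
    push_cast; ring
  have hsum : Summable fun j => ‖((PowerSeries.coeff j P : ℝ) : ℂ) * z ^ j‖ := by
    refine hP.hasSum.summable.congr fun j => ?_
    rw [norm_mul, norm_pow, hz1, one_pow, mul_one, Complex.norm_real,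
      Real.norm_of_nonneg (hP.nonneg j)]
  have hpow := summable_norm_pow_and_value_pow (𝕜 := ℂ) hsum n
  have hval : centredCharFun P θ = Complex.exp ((-θ : ℝ) * Complex.I) * value P z := by
    rw [centredCharFun, value, ← tsum_mul_left]
    refine tsum_congr fun j => ?_
    rw [hzp, mul_left_comm, ← Complex.exp_add]
    congr 2
    push_cast; ring
  have h1 := hpow.1.of_norm.hasSum
  change HasSum _ (value (P ^ n) z) at h1
  rw [hpow.2] at h1
  have h2 := h1.mul_left (Complex.exp ((-m * θ : ℝ) * Complex.I))
  have e : Complex.exp ((((n : ℝ) - m) * θ : ℝ) * Complex.I) * centredCharFun P θ ^ n =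
      Complex.exp ((-m * θ : ℝ) * Complex.I) * value P z ^ n := by
    rw [hval, mul_pow, ← Complex.exp_nat_mul, ← mul_assoc, ← Complex.exp_add]
    congr 2
    push_cast; ring
  rw [e]
  refine h2.congr_fun fun j => ?_
  change _ = _ * (((PowerSeries.coeff j (P ^ n) : ℝ) : ℂ) * z ^ j)
  rw [hzp, mul_left_comm, ← Complex.exp_add]
  congr 2
  push_cast; ring

/-- The characteristic function has modulus `1` in `[-π / Q, π / Q]` only at the origin. Since there
is an atom at `0`, modulus `1` at `θ` puts the support inside `{j | j θ ∈ 2 π ℤ}`; this is the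
trace of a subgroup of `ℤ`, which then contains `Q`. -/
theorem eq_zero_of_one_le_norm (hP : CriticalLaw Q P) {θ : ℝ} (hθ : |θ| ≤ Real.pi / Q)
    (h : 1 ≤ ‖centredCharFun P θ‖) : θ = 0 := by
  set u : ℂ := Complex.exp (θ * Complex.I) * centredCharFun P θ with hu
  have hu1 : ‖u‖ = 1 := by
    rw [hu, norm_mul, Complex.norm_exp_ofReal_mul_I, one_mul]
    exact le_antisymm (hP.norm_centredCharFun_le_one θ) h
  have hs : HasSum (fun j : ℕ => ((PowerSeries.coeff j P : ℝ) : ℂ) *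
      Complex.exp (((j * θ : ℝ) : ℂ) * Complex.I)) u := by
    have := hP.hasSum_exp_mul_pow 1 0 θ
    simpa [hu] using this
  have hsre : HasSum (fun j : ℕ => PowerSeries.coeff j P *
      (Complex.exp (((j * θ : ℝ) : ℂ) * Complex.I) * (starRingEnd ℂ) u).re) 1 := by
    have h1 := Complex.hasSum_re (hs.mul_right ((starRingEnd ℂ) u))
    rw [Complex.mul_conj, Complex.normSq_eq_norm_sq, hu1] at h1
    simp only [one_pow, Complex.ofReal_one, Complex.one_re] at h1
    refine h1.congr_fun fun j => ?_
    rw [mul_assoc, Complex.re_ofReal_mul]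
  have hle : ∀ j : ℕ, (Complex.exp (((j * θ : ℝ) : ℂ) * Complex.I) * (starRingEnd ℂ) u).re ≤ 1 := by
    intro j
    refine (Complex.re_le_norm _).trans ?_
    rw [norm_mul, Complex.norm_exp_ofReal_mul_I, RCLike.norm_conj, hu1, one_mul]
  have hall : ∀ j : ℕ, PowerSeries.coeff j P ≠ 0 →
      (Complex.exp (((j * θ : ℝ) : ℂ) * Complex.I) * (starRingEnd ℂ) u).re = 1 := by
    intro j hj
    have h1 := hP.hasSum.sub hsre
    rw [sub_self] at h1
    have h2 := (hasSum_zero_iff_of_nonneg fun i => sub_nonneg.2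
      (mul_le_of_le_one_right (hP.nonneg i) (hle i))).1 h1
    have h3 := congrFun h2 j
    simp only [Pi.zero_apply] at h3
    refine mul_left_cancel₀ hj ?_
    linarith
  have hure : u.re = 1 := by simpa using hall 0 hP.zero_pos.ne'
  have hu' : u = 1 := by
    have h1 : u.re ^ 2 + u.im ^ 2 = 1 := by
      have := Complex.normSq_eq_norm_sq u
      rw [Complex.normSq_apply, hu1] at this
      linarith
    have h2 : u.im = 0 := by
      rw [hure] at h1
      exact pow_eq_zero_iff (n := 2) (by norm_num) |>.1 (by linarith)
    exact Complex.ext hure h2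
  have hmem : ∀ j : ℕ, PowerSeries.coeff j P ≠ 0 →
      (j : ℤ) ∈ (AddSubgroup.zmultiples (2 * Real.pi)).comap (zmultiplesHom ℝ θ) := by
    intro j hj
    have h1 := hall j hj
    rw [hu', map_one, mul_one, Complex.exp_ofReal_mul_I_re, Real.cos_eq_one_iff] at h1
    obtain ⟨k, hk⟩ := h1
    rw [AddSubgroup.mem_comap, AddSubgroup.mem_zmultiples_iff]
    exact ⟨k, by simpa using hk⟩
  obtain ⟨d, hd⟩ := Int.subgroup_cyclic
    ((AddSubgroup.zmultiples (2 * Real.pi)).comap (zmultiplesHom ℝ θ))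
  rw [← AddSubgroup.zmultiples_eq_closure] at hd
  have hdQ : d.natAbs ∣ Q := by
    refine hP.dvd_period _ fun j hj => ?_
    have h1 := hmem j hj
    rw [hd, Int.mem_zmultiples_iff] at h1
    exact (Nat.modEq_zero_iff_dvd).2 (Int.natAbs_dvd_natAbs.2 h1)
  have hQ : (Q : ℤ) ∈ (AddSubgroup.zmultiples (2 * Real.pi)).comap (zmultiplesHom ℝ θ) := by
    rw [hd, Int.mem_zmultiples_iff]
    exact Int.natAbs_dvd.1 (Int.natCast_dvd_natCast.2 hdQ)
  rw [AddSubgroup.mem_comap, AddSubgroup.mem_zmultiples_iff] at hQ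
  obtain ⟨k, hk⟩ := hQ
  have hk' : (k : ℝ) * (2 * Real.pi) = Q * θ := by simpa using hk
  have hQ0 : (0 : ℝ) < Q := by exact_mod_cast hP.period_pos
  have hb : |(k : ℝ)| * (2 * Real.pi) ≤ Real.pi := by
    have h1 : |(k : ℝ) * (2 * Real.pi)| = Q * |θ| := by
      rw [hk', abs_mul, abs_of_pos hQ0]
    rw [abs_mul, abs_of_pos Real.two_pi_pos] at h1
    rw [h1]
    calc (Q : ℝ) * |θ| ≤ Q * (Real.pi / Q) := by gcongr
      _ = Real.pi := by field_simp
  have hk0 : k = 0 := by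
    by_contra hne
    have h1 : (1 : ℝ) ≤ |(k : ℝ)| := by exact_mod_cast Int.one_le_abs hne
    nlinarith [Real.pi_pos]
  rw [hk0, Int.cast_zero, zero_mul] at hk'
  exact (mul_eq_zero.1 hk'.symm).resolve_left hQ0.ne'

/-- Near `0` the bound comes from the second order expansion; on the rest of the period the modulus
stays away from `1` by compactness. -/
theorem exists_gaussian_bound (hP : CriticalLaw Q P) : ∃ c, 0 < c ∧
    ∀ θ : ℝ, |θ| ≤ Real.pi / Q → ‖centredCharFun P θ‖ ≤ Real.exp (-(c * θ ^ 2)) := by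
  obtain ⟨v, M, hv, hM, hT⟩ := hP.exists_taylor
  have hQ0 : (0 : ℝ) < Q := by exact_mod_cast hP.period_pos
  set B := Real.pi / Q with hB
  have hB0 : 0 < B := div_pos Real.pi_pos hQ0
  obtain ⟨δ, hδ0, hδM, hδv⟩ : ∃ δ : ℝ, 0 < δ ∧ M * δ ≤ v / 4 ∧ v * δ ^ 2 ≤ 2 := by
    have h1 : Tendsto (fun δ : ℝ => M * δ) (𝓝[>] 0) (𝓝 (M * 0)) :=
      ((continuous_const.mul continuous_id).tendsto 0).mono_left nhdsWithin_le_nhds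
    have h2 : Tendsto (fun δ : ℝ => v * δ ^ 2) (𝓝[>] 0) (𝓝 (v * 0 ^ 2)) :=
      ((continuous_const.mul (continuous_id.pow 2)).tendsto 0).mono_left nhdsWithin_le_nhds
    have h3 : ∀ᶠ δ in 𝓝[>] (0 : ℝ), 0 < δ := self_mem_nhdsWithin
    exact (h3.and ((h1.eventually_le_const (by rw [mul_zero]; linarith)).and
      (h2.eventually_le_const (by norm_num)))).exists
  have hnear : ∀ θ : ℝ, |θ| ≤ δ → ‖centredCharFun P θ‖ ≤ 1 - v / 4 * θ ^ 2 := by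
    intro θ hθ
    have hsq : θ ^ 2 ≤ δ ^ 2 := by rw [← sq_abs]; gcongr
    have h1 : ‖(1 - (v * θ ^ 2 / 2 : ℝ) : ℂ)‖ = 1 - v * θ ^ 2 / 2 := by
      rw [← Complex.ofReal_one, ← Complex.ofReal_sub, Complex.norm_real, Real.norm_of_nonneg]
      nlinarith
    have h2 : M * |θ| ^ 3 ≤ v / 4 * θ ^ 2 := by
      calc M * |θ| ^ 3 = M * |θ| * θ ^ 2 := by rw [← sq_abs θ]; ring
        _ ≤ M * δ * θ ^ 2 := by gcongr
        _ ≤ _ := by gcongr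
    have h3 := norm_le_norm_add_norm_sub' (centredCharFun P θ) (1 - (v * θ ^ 2 / 2 : ℝ) : ℂ)
    have h4 := hT θ
    linarith
  obtain ⟨η, hη0, hη⟩ : ∃ η : ℝ, 0 < η ∧
      ∀ θ : ℝ, δ ≤ |θ| → |θ| ≤ B → ‖centredCharFun P θ‖ ≤ 1 - η := by
    set K : Set ℝ := {θ | δ ≤ |θ|} ∩ Set.Icc (-B) B with hK
    have hKc : IsCompact K :=
      isCompact_Icc.inter_left (isClosed_le continuous_const continuous_abs)
    rcases K.eq_empty_or_nonempty with hE | hN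
    · refine ⟨1, one_pos, fun θ h1 h2 => ?_⟩
      have : θ ∈ K := ⟨h1, abs_le.1 h2⟩
      rw [hE] at this
      exact absurd this (Set.notMem_empty θ)
    · obtain ⟨θ₀, hθ₀, hmax⟩ := hKc.exists_isMaxOn hN hP.continuous_centredCharFun.norm.continuousOn
      refine ⟨1 - ‖centredCharFun P θ₀‖, ?_, fun θ h1 h2 => ?_⟩
      · rw [sub_pos]
        by_contra hcon
        have := hP.eq_zero_of_one_le_norm (abs_le.2 hθ₀.2) (not_lt.1 hcon)
        have h3 : δ ≤ |θ₀| := hθ₀.1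
        rw [this, abs_zero] at h3
        linarith
      · have : ‖centredCharFun P θ‖ ≤ ‖centredCharFun P θ₀‖ := hmax ⟨h1, abs_le.1 h2⟩
        linarith
  refine ⟨min (v / 4) (η / B ^ 2), by positivity, fun θ hθ => ?_⟩
  have hexp := Real.add_one_le_exp (-(min (v / 4) (η / B ^ 2) * θ ^ 2))
  refine le_trans ?_ hexp
  rcases le_total |θ| δ with h | h
  · have := hnear θ h
    have h2 : min (v / 4) (η / B ^ 2) * θ ^ 2 ≤ v / 4 * θ ^ 2 := by
      gcongr; exact min_le_left _ _
    linarith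
  · have := hη θ h hθ
    have hsq : θ ^ 2 ≤ B ^ 2 := by rw [← sq_abs]; gcongr
    have h2 : min (v / 4) (η / B ^ 2) * θ ^ 2 ≤ η := by
      calc _ ≤ η / B ^ 2 * B ^ 2 := by gcongr; exact min_le_right _ _
        _ = η := by field_simp
    linarith

theorem integral_exp_period {k : ℤ} {Q : ℕ} (hQ : 0 < Q) :
    ∫ θ in (-(Real.pi / Q))..(Real.pi / Q), Complex.exp (((k * Q : ℝ) * θ : ℝ) * Complex.I) =
      if k = 0 then ((2 * Real.pi / Q : ℝ) : ℂ) else 0 := by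
  have hQ0 : (Q : ℂ) ≠ 0 := by exact_mod_cast hQ.ne'
  split_ifs with h
  · subst h
    simp
    ring
  · have hk : (k : ℂ) ≠ 0 := by exact_mod_cast h
    have hc : (k : ℂ) * Q * Complex.I ≠ 0 := mul_ne_zero (mul_ne_zero hk hQ0) Complex.I_ne_zero
    have e : ∀ θ : ℝ, Complex.exp (((k * Q : ℝ) * θ : ℝ) * Complex.I) =
        Complex.exp ((k : ℂ) * Q * Complex.I * θ) := fun θ => by
      congr 1; push_cast; ring
    simp_rw [e]
    rw [integral_exp_mul_complex hc, div_eq_zero_iff]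
    left
    rw [sub_eq_zero, Complex.exp_eq_exp_iff_exists_int]
    refine ⟨k, ?_⟩
    push_cast
    field_simp
    ring

/-- Fourier inversion over one period. -/
theorem integral_eq_coeff (hP : CriticalLaw Q P) {n : ℕ} (hn : 0 < n) (hnQ : n ≡ 1 [MOD Q]) :
    ∫ θ in (-(Real.pi / Q))..(Real.pi / Q),
      Complex.exp (θ * Complex.I) * centredCharFun P θ ^ n =
      ((2 * Real.pi / Q * PowerSeries.coeff (n - 1) (P ^ n) : ℝ) : ℂ) := by
  have hpn := coeff_pow_nonneg hP.nonneg n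
  have hsumn : Summable fun j => PowerSeries.coeff j (P ^ n) := by
    have := (summable_norm_pow_and_value_pow (f := P) (z := (1 : ℝ))
      (by simpa using hP.hasSum.summable.abs) n).1
    simp only [RCLike.ofReal_real_eq_id, id_eq, one_pow, mul_one] at this
    exact this.of_norm
  have hS := intervalIntegral.hasSum_integral_of_dominated_convergence
    (μ := MeasureTheory.volume) (a := -(Real.pi / Q)) (b := Real.pi / Q)
    (F := fun (j : ℕ) (θ : ℝ) => ((PowerSeries.coeff j (P ^ n) : ℝ) : ℂ) *
      Complex.exp (((((j : ℝ) - (n - 1 : ℕ)) * θ : ℝ) : ℂ) * Complex.I))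
    (f := fun θ : ℝ => Complex.exp (θ * Complex.I) * centredCharFun P θ ^ n)
    (fun j _ => PowerSeries.coeff j (P ^ n))
    (fun j => Continuous.aestronglyMeasurable (by fun_prop))
    (fun j => Eventually.of_forall fun θ _ => by
      rw [norm_mul, Complex.norm_exp_ofReal_mul_I, mul_one, Complex.norm_real,
        Real.norm_of_nonneg (hpn j)])
    (Eventually.of_forall fun θ _ => hsumn) intervalIntegrable_const
    (Eventually.of_forall fun θ _ => by
      have h := hP.hasSum_exp_mul_pow n (n - 1) θ
      have e : ((n : ℝ) - (n - 1 : ℕ)) * θ = θ := by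
        rw [Nat.cast_sub hn]; push_cast; ring
      rw [e] at h
      exact h)
  refine hS.unique ?_
  have hsingle := hasSum_single (n - 1) (f := fun j : ℕ =>
    ∫ θ in (-(Real.pi / Q))..(Real.pi / Q), ((PowerSeries.coeff j (P ^ n) : ℝ) : ℂ) *
      Complex.exp (((((j : ℝ) - (n - 1 : ℕ)) * θ : ℝ) : ℂ) * Complex.I)) ?_
  · have e : ((2 * Real.pi / Q * PowerSeries.coeff (n - 1) (P ^ n) : ℝ) : ℂ) =
        ∫ θ in (-(Real.pi / Q))..(Real.pi / Q), ((PowerSeries.coeff (n - 1) (P ^ n) : ℝ) : ℂ) *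
          Complex.exp ((((((n - 1 : ℕ) : ℝ) - (n - 1 : ℕ)) * θ : ℝ) : ℂ) * Complex.I) := by
      simp only [sub_self, zero_mul, Complex.ofReal_zero, Complex.exp_zero, mul_one,
        intervalIntegral.integral_const, sub_neg_eq_add, Complex.real_smul]
      push_cast
      ring
    rw [e]
    exact hsingle
  · -- a frequency `j - (n - 1)` in the support is a multiple of `Q`, so it integrates to `0`
    intro j hj
    rw [intervalIntegral.integral_const_mul]
    by_cases hc : PowerSeries.coeff j (P ^ n) = 0
    · rw [hc]; simp
    have h1 : j ≡ 0 [MOD Q] := by simpa using hP.supp.pow n j hc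
    have h2 : n - 1 ≡ 0 [MOD Q] := by
      refine Nat.ModEq.add_right_cancel' 1 ?_
      rwa [Nat.sub_add_cancel hn]
    obtain ⟨a, rfl⟩ := (Nat.modEq_zero_iff_dvd).1 h1
    obtain ⟨b, hb⟩ := (Nat.modEq_zero_iff_dvd).1 h2
    rw [hb] at hj ⊢
    have h3 := integral_exp_period (k := (a : ℤ) - b) hP.period_pos
    have hab : (a : ℤ) - b ≠ 0 := by
      intro h
      apply hj
      have : a = b := by omega
      rw [this]
    rw [if_neg hab] at h3
    have e : (((Q * a : ℕ) : ℝ) - ((Q * b : ℕ) : ℝ)) = (((a : ℤ) - b : ℤ) : ℝ) * Q := by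
      push_cast; ring
    rw [e, h3, mul_zero]

/-- After the substitution `θ = t / √n` the integrand converges to a Gaussian and is dominated by
one. -/
theorem tendsto_sqrt_mul_integral (hP : CriticalLaw Q P) : ∃ K : ℝ, 0 < K ∧
    Tendsto (fun n : ℕ => (√n : ℂ) * ∫ θ in (-(Real.pi / Q))..(Real.pi / Q),
      Complex.exp (θ * Complex.I) * centredCharFun P θ ^ n) atTop (𝓝 (K : ℂ)) := by
  obtain ⟨v, M, hv, hM, hT⟩ := hP.exists_taylor
  obtain ⟨c, hc, hbound⟩ := hP.exists_gaussian_bound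
  have hQ0 : (0 : ℝ) < Q := by exact_mod_cast hP.period_pos
  set B := Real.pi / Q with hB
  have hB0 : 0 < B := div_pos Real.pi_pos hQ0
  have hcont := hP.continuous_centredCharFun
  refine ⟨∫ t : ℝ, Real.exp (-(v / 2) * t ^ 2), ?_, ?_⟩
  · rw [integral_gaussian]
    have := Real.pi_pos
    positivity
  have hsqrt : Tendsto (fun n : ℕ => √(n : ℝ)) atTop atTop :=
    Real.tendsto_sqrt_atTop.comp tendsto_natCast_atTop_atTop
  set F : ℕ → ℝ → ℂ := fun n => (Set.Ioc (-(B * √n)) (B * √n)).indicator fun t =>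
    Complex.exp ((t / √n : ℝ) * Complex.I) * centredCharFun P (t / √n) ^ n with hF
  have hlim : Tendsto (fun n => ∫ t, F n t) atTop
      (𝓝 (∫ t : ℝ, ((Real.exp (-(v / 2) * t ^ 2) : ℝ) : ℂ))) := by
    refine MeasureTheory.tendsto_integral_of_dominated_convergence
      (fun t => Real.exp (-c * t ^ 2)) (fun n => ?_) (integrable_exp_neg_mul_sq hc)
      (fun n => Eventually.of_forall fun t => ?_) (Eventually.of_forall fun t => ?_)
    · refine (Continuous.aestronglyMeasurable ?_).indicator measurableSet_Ioc
      fun_prop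
    · rw [hF]
      simp only
      by_cases ht : t ∈ Set.Ioc (-(B * √n)) (B * √n)
      · rw [Set.indicator_of_mem ht, norm_mul, Complex.norm_exp_ofReal_mul_I, one_mul, norm_pow]
        have hs0 : 0 < √(n : ℝ) := by
          by_contra h
          have h0 : √(n : ℝ) = 0 := le_antisymm (not_lt.1 h) (Real.sqrt_nonneg _)
          rw [h0, mul_zero, neg_zero, Set.Ioc_self] at ht
          exact ht
        have h1 : |t / √n| ≤ B := by
          rw [abs_div, abs_of_pos hs0, div_le_iff₀ hs0]
          exact abs_le.2 ⟨ht.1.le, ht.2⟩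
        refine (pow_le_pow_left₀ (norm_nonneg _) (hbound _ h1) n).trans_eq ?_
        rw [← Real.exp_nat_mul]
        congr 1
        have h2 : √(n : ℝ) ^ 2 = n := Real.sq_sqrt n.cast_nonneg
        rw [div_pow, h2]
        have h3 : (n : ℝ) ≠ 0 := by rw [← h2]; positivity
        field_simp
      · rw [Set.indicator_of_notMem ht, norm_zero]
        exact (Real.exp_pos _).le
    · have hev : ∀ᶠ n : ℕ in atTop, t ∈ Set.Ioc (-(B * √n)) (B * √n) := by
        filter_upwards [(hsqrt.const_mul_atTop hB0).eventually_gt_atTop |t|] with n hn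
        have := abs_lt.1 hn
        exact ⟨this.1, this.2.le⟩
      have ht0 : Tendsto (fun n : ℕ => t / √n) atTop (𝓝 0) := hsqrt.const_div_atTop t
      have h1 : Tendsto (fun n : ℕ => Complex.exp ((t / √n : ℝ) * Complex.I)) atTop (𝓝 1) := by
        have h : Continuous fun s : ℝ => Complex.exp (s * Complex.I) := by fun_prop
        have h' := (h.tendsto 0).comp ht0
        simpa [Function.comp_def] using h'
      have h2 : Tendsto (fun n : ℕ => (n : ℂ) * (centredCharFun P (t / √n) - 1)) atTop
          (𝓝 ((-(v / 2) * t ^ 2 : ℝ) : ℂ)) := by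
        rw [tendsto_iff_norm_sub_tendsto_zero]
        refine squeeze_zero' (g := fun n : ℕ => M * |t| ^ 3 / √n)
          (Eventually.of_forall fun n => norm_nonneg _) ?_ (hsqrt.const_div_atTop _)
        filter_upwards [eventually_gt_atTop 0] with n hn
        have hn0 : (0 : ℝ) < n := by exact_mod_cast hn
        have hs0 : 0 < √(n : ℝ) := Real.sqrt_pos.2 hn0
        have hsq : √(n : ℝ) ^ 2 = n := Real.sq_sqrt hn0.le
        have e1 : (n : ℂ) * (centredCharFun P (t / √n) - 1) - ((-(v / 2) * t ^ 2 : ℝ) : ℂ) =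
            (n : ℂ) * (centredCharFun P (t / √n) - (1 - (v * (t / √n) ^ 2 / 2 : ℝ))) := by
          have e2 : v * (t / √n) ^ 2 / 2 = v / 2 * t ^ 2 / n := by
            rw [div_pow, hsq]; ring
          have hnC : (n : ℂ) ≠ 0 := by exact_mod_cast hn.ne'
          rw [e2]
          push_cast
          field_simp
          ring
        rw [e1, norm_mul, Complex.norm_natCast]
        refine (mul_le_mul_of_nonneg_left (hT _) hn0.le).trans_eq ?_
        rw [abs_div, abs_of_pos hs0]
        nth_rewrite 1 [← hsq]
        field_simp
      have h3 := Complex.tendsto_one_add_pow_exp_of_tendsto h2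
      have h4 := h1.mul h3
      rw [one_mul, ← Complex.ofReal_exp] at h4
      refine h4.congr' ?_
      filter_upwards [hev] with n hn
      rw [hF]
      simp only
      rw [Set.indicator_of_mem hn, add_sub_cancel]
  rw [integral_complex_ofReal] at hlim
  refine hlim.congr' ?_
  filter_upwards [eventually_gt_atTop 0] with n hn
  have hs0 : 0 < √(n : ℝ) := Real.sqrt_pos.2 (by exact_mod_cast hn)
  have h1 := intervalIntegral.integral_comp_div (a := -(B * √n)) (b := B * √n)
    (fun θ : ℝ => Complex.exp (θ * Complex.I) * centredCharFun P θ ^ n) hs0.ne'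
  rw [neg_div, mul_div_cancel_right₀ _ hs0.ne'] at h1
  rw [hF, MeasureTheory.integral_indicator measurableSet_Ioc,
    ← intervalIntegral.integral_of_le (by have := mul_pos hB0 hs0; linarith), h1, Complex.real_smul]

/-- The local limit theorem: the law of a sum of `n` independent copies puts mass asymptotic to
`K / √n` at `n - 1`, for `n` in the class where that value lies on the lattice. -/
theorem tendsto_sqrt_mul_coeff (hP : CriticalLaw Q P) : ∃ K : ℝ, 0 < K ∧
    Tendsto (fun n : ℕ => √n * PowerSeries.coeff (n - 1) (P ^ n))
      (atTop ⊓ 𝓟 {n | n ≡ 1 [MOD Q]}) (𝓝 K) := by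
  obtain ⟨K, hK, hlim⟩ := hP.tendsto_sqrt_mul_integral
  have hQ0 : (0 : ℝ) < Q := by exact_mod_cast hP.period_pos
  have hpi := Real.pi_pos
  refine ⟨(2 * Real.pi / Q)⁻¹ * K, by positivity, ?_⟩
  have h1 := ((Complex.continuous_re.tendsto _).comp hlim).mono_left
    (inf_le_left (b := 𝓟 {n | n ≡ 1 [MOD Q]}))
  rw [Complex.ofReal_re] at h1
  refine (h1.const_mul (2 * Real.pi / Q)⁻¹).congr' ?_
  have hmem : ∀ᶠ n in atTop ⊓ 𝓟 {n | n ≡ 1 [MOD Q]}, n ≡ 1 [MOD Q] :=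
    (eventually_principal.2 fun n hn => hn).filter_mono inf_le_right
  filter_upwards [(eventually_gt_atTop 0).filter_mono inf_le_left, hmem] with n hn hnQ
  simp only [Function.comp]
  rw [hP.integral_eq_coeff hn hnQ, ← Complex.ofReal_mul, Complex.ofReal_re]
  field_simp

end CriticalLaw

/-! ### The period and the critical law of a series at its apex -/

theorem isGreatest_period {ψ : PowerSeries ℝ} (hψ : ClassK ψ) :
    IsGreatest {d : ℕ | ∀ n : ℕ, 0 < n → 0 < PowerSeries.coeff n ψ → d ∣ n} (period ψ) := by
  obtain ⟨n, hn0, hn⟩ := hψ.nonconstant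
  have hbdd : BddAbove {d : ℕ | ∀ n : ℕ, 0 < n → 0 < PowerSeries.coeff n ψ → d ∣ n} :=
    ⟨n, fun d hd => Nat.le_of_dvd hn0 (hd n hn0 (lt_of_le_of_ne (hψ.coeff_nonneg n) hn.symm))⟩
  exact ⟨Nat.sSup_mem ⟨1, fun n _ _ => one_dvd n⟩ hbdd, fun d hd => le_csSup hbdd hd⟩

theorem period_pos {ψ : PowerSeries ℝ} (hψ : ClassK ψ) : 0 < period ψ :=
  (isGreatest_period hψ).2 fun n _ _ => one_dvd n

/-- The constant term, which `period` disregards, lies in the class of `0` in any case. -/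
theorem suppMod_zero_iff {ψ : PowerSeries ℝ} (hψ : ClassK ψ) (d : ℕ) :
    SuppMod d 0 ψ ↔ ∀ n : ℕ, 0 < n → 0 < PowerSeries.coeff n ψ → d ∣ n := by
  constructor
  · exact fun h n _ hn => Nat.modEq_zero_iff_dvd.1 (h n hn.ne')
  · intro h n hn
    rcases Nat.eq_zero_or_pos n with rfl | hn0
    · rfl
    · exact Nat.modEq_zero_iff_dvd.2
        (h n hn0 (lt_of_le_of_ne (hψ.coeff_nonneg n) (Ne.symm hn)))

theorem suppMod_period {ψ : PowerSeries ℝ} (hψ : ClassK ψ) : SuppMod (period ψ) 0 ψ :=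
  (suppMod_zero_iff hψ _).2 (isGreatest_period hψ).1

/-- The greatest element for `≤` is also greatest for divisibility, because the least common
multiple of two common divisors is a common divisor. -/
theorem dvd_period {ψ : PowerSeries ℝ} (hψ : ClassK ψ) {d : ℕ} (hd : SuppMod d 0 ψ) :
    d ∣ period ψ := by
  have hd' := (suppMod_zero_iff hψ d).1 hd
  obtain ⟨hmem, hmax⟩ := isGreatest_period hψ
  have hl : d.lcm (period ψ) ≤ period ψ :=
    hmax fun n hn0 hn => Nat.lcm_dvd (hd' n hn0 hn) (hmem n hn0 hn)
  have hpos : 0 < d.lcm (period ψ) := by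
    refine Nat.lcm_pos (Nat.pos_of_ne_zero ?_) (period_pos hψ)
    rintro rfl
    obtain ⟨n, hn0, hn⟩ := hψ.nonconstant
    exact hn0.ne' (Nat.zero_dvd.1 (hd' n hn0 (lt_of_le_of_ne (hψ.coeff_nonneg n) hn.symm)))
  have heq : d.lcm (period ψ) = period ψ :=
    le_antisymm hl (Nat.le_of_dvd hpos (Nat.dvd_lcm_right _ _))
  exact heq ▸ Nat.dvd_lcm_left d (period ψ)

theorem IsApex.exists_summable {ψ : PowerSeries ℝ} {τ : ℝ} (hψ : ClassK ψ) (hτ : IsApex ψ τ) :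
    ∃ r, τ < r ∧ Summable fun j => PowerSeries.coeff j ψ * r ^ j := by
  obtain ⟨r, hr1, hr2⟩ := ENNReal.lt_iff_exists_nnreal_btwn.1 hτ.lt_radius
  refine ⟨r, ?_, ?_⟩
  · rw [← ENNReal.ofReal_coe_nnreal] at hr1
    exact (ENNReal.ofReal_lt_ofReal_iff_of_nonneg hτ.pos.le).1 hr1
  · refine (FormalMultilinearSeries.summable_norm_mul_pow _ hr2).congr fun j => ?_
    rw [FormalMultilinearSeries.ofScalars_norm, Real.norm_of_nonneg (hψ.coeff_nonneg j)]

theorem summable_coeff_mul_pow_of_le {ψ : PowerSeries ℝ} (hψ : ∀ n, 0 ≤ PowerSeries.coeff n ψ)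
    {s r : ℝ} (hs : 0 ≤ s) (hsr : s ≤ r)
    (hr : Summable fun j => PowerSeries.coeff j ψ * r ^ j) :
    Summable fun j => PowerSeries.coeff j ψ * s ^ j :=
  Summable.of_nonneg_of_le (fun j => mul_nonneg (hψ j) (pow_nonneg hs j))
    (fun j => mul_le_mul_of_nonneg_left (pow_le_pow_left₀ hs hsr j) (hψ j)) hr

theorem IsApex.hasSum_value {ψ : PowerSeries ℝ} {τ : ℝ} (hψ : ClassK ψ) (hτ : IsApex ψ τ) :
    HasSum (fun j => PowerSeries.coeff j ψ * τ ^ j) (value ψ τ) := by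
  obtain ⟨r, hr, hs⟩ := hτ.exists_summable hψ
  exact (summable_coeff_mul_pow_of_le hψ.coeff_nonneg hτ.pos.le hr.le hs).hasSum

theorem IsApex.value_pos {ψ : PowerSeries ℝ} {τ : ℝ} (hψ : ClassK ψ) (hτ : IsApex ψ τ) :
    0 < value ψ τ := by
  have h := le_hasSum (hτ.hasSum_value hψ) 0 fun j _ =>
    mul_nonneg (hψ.coeff_nonneg j) (pow_nonneg hτ.pos.le j)
  have := hψ.coeff_zero_pos
  rw [pow_zero, mul_one] at h
  linarith

/-- The member of the Khinchin family of `ψ` at `τ`, as a generating function: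
`ψ(τ z) / ψ(τ)`. -/
noncomputable def khinchinLaw (ψ : PowerSeries ℝ) (τ : ℝ) : PowerSeries ℝ :=
  (value ψ τ)⁻¹ • PowerSeries.rescale τ ψ

theorem coeff_khinchinLaw (ψ : PowerSeries ℝ) (τ : ℝ) (j : ℕ) :
    PowerSeries.coeff j (khinchinLaw ψ τ) = PowerSeries.coeff j ψ * τ ^ j / value ψ τ := by
  rw [khinchinLaw, PowerSeries.coeff_smul, PowerSeries.coeff_rescale, smul_eq_mul]
  ring

theorem coeff_khinchinLaw_pow (ψ : PowerSeries ℝ) (τ : ℝ) (n j : ℕ) :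
    PowerSeries.coeff j (khinchinLaw ψ τ ^ n) =
      PowerSeries.coeff j (ψ ^ n) * τ ^ j / value ψ τ ^ n := by
  rw [khinchinLaw, smul_pow, ← map_pow, PowerSeries.coeff_smul, PowerSeries.coeff_rescale,
    smul_eq_mul, inv_pow]
  ring

theorem IsApex.criticalLaw {ψ : PowerSeries ℝ} {τ : ℝ} (hψ : ClassK ψ) (hτ : IsApex ψ τ) :
    CriticalLaw (period ψ) (khinchinLaw ψ τ) := by
  obtain ⟨r, hr, hs⟩ := hτ.exists_summable hψ
  have hv := hτ.value_pos hψ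
  have hτ0 := hτ.pos
  have hne : ∀ j, PowerSeries.coeff j (khinchinLaw ψ τ) ≠ 0 ↔ PowerSeries.coeff j ψ ≠ 0 := by
    intro j
    rw [coeff_khinchinLaw]
    simp [hv.ne', hτ0.ne']
  have hmom := summable_coeff_mul_natPow hτ0 hr hψ.coeff_nonneg hs
  refine ⟨fun n => ?_, ?_, ?_, ?_, ?_, period_pos hψ, fun n hn => ?_, fun d hd => ?_⟩
  · rw [coeff_khinchinLaw]
    have := hψ.coeff_nonneg n
    positivity
  · rw [coeff_khinchinLaw]
    have := hψ.coeff_zero_pos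
    positivity
  · have h := (hτ.hasSum_value hψ).div_const (value ψ τ)
    rw [div_self hv.ne'] at h
    exact h.congr_fun fun j => coeff_khinchinLaw ψ τ j
  · have h : Summable fun n : ℕ => (n : ℝ) * PowerSeries.coeff n (khinchinLaw ψ τ) := by
      refine ((hmom 1).div_const (value ψ τ)).congr fun n => ?_
      rw [coeff_khinchinLaw, pow_one, mul_div_assoc]
    have hm := hτ.mean_eq_one
    rw [mean] at hm
    rw [← hm]
    simpa only [coeff_khinchinLaw] using h.hasSum
  · refine ((hmom 3).div_const (value ψ τ)).congr fun n => ?_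
    rw [coeff_khinchinLaw, mul_div_assoc]
  · exact suppMod_period hψ n ((hne n).1 hn)
  · exact dvd_period hψ fun n hn => hd n ((hne n).2 hn)

/-! ### The rescaled Lagrange solution and its iterates -/

/-- The rescaled coefficients `Aₙ ρ ^ n` are asymptotic to `c n ^ (-3/2)` on the class of `1` modulo
the period, and their sum is the apex. -/
theorem IsLagrangeSolution.exists_coeffAsymp {ψ g : PowerSeries ℝ} {τ ρ : ℝ} (hψ : ClassK ψ)
    (hτ : IsApex ψ τ) (hρ : ρ = τ / value ψ τ) (hg : IsLagrangeSolution ψ g) :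
    ∃ c, 0 < c ∧ CoeffAsymp (period ψ) 1 (PowerSeries.rescale ρ g) c τ := by
  have hv := hτ.value_pos hψ
  have hτ0 := hτ.pos
  have hρ0 : 0 < ρ := hρ ▸ div_pos hτ0 hv
  have hfix : ρ * value ψ τ = τ := by rw [hρ, div_mul_cancel₀ _ hv.ne']
  have hP := hτ.criticalLaw hψ
  obtain ⟨r, hr, hs⟩ := hτ.exists_summable hψ
  set f := PowerSeries.rescale ρ g with hf
  have hfn : ∀ n, 0 ≤ PowerSeries.coeff n f := fun n => by
    rw [hf, PowerSeries.coeff_rescale]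
    exact mul_nonneg (pow_nonneg hρ0.le n) (hg.coeff_nonneg hψ.coeff_nonneg n)
  have hf0 : PowerSeries.coeff 0 f = 0 := by
    rw [hf, PowerSeries.coeff_rescale, hg.coeff_zero, mul_zero]
  have heq : ∀ n, PowerSeries.coeff (n + 1) f =
      ρ * PowerSeries.coeff n (PowerSeries.subst f ψ) := by
    intro n
    rw [hf, ← rescale_subst hg.coeff_zero, PowerSeries.coeff_rescale, PowerSeries.coeff_rescale]
    conv_lhs => rw [hg.equation]
    rw [PowerSeries.coeff_succ_X_mul, pow_succ]
    ring
  have hle := sum_range_coeff_le hρ0.le hτ0.le hfn hf0 hψ.coeff_nonneg (hτ.hasSum_value hψ) hfix heq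
  have hsumm : Summable fun n => PowerSeries.coeff n f := summable_of_sum_range_le hfn hle
  obtain ⟨T, hT⟩ := hsumm
  have hT0 : 0 ≤ T := hT.nonneg hfn
  have hTτ : T ≤ τ := le_of_tendsto' hT.tendsto_sum_nat hle
  have hTs := summable_coeff_mul_pow_of_le hψ.coeff_nonneg hT0 (hTτ.trans hr.le) hs
  have hTfix : T = ρ * value ψ T := by
    have h1 := (hasSum_coeff_subst_value hfn hf0 hT hψ.coeff_nonneg hTs).mul_left ρ
    have h2 := (hasSum_nat_add_iff' 1).2 hT
    rw [Finset.sum_range_one, hf0, sub_zero] at h2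
    exact h2.unique (h1.congr_fun heq)
  -- `T / τ` is a fixed point of the generating function of the critical law
  have hTeq : T = τ := by
    have h1 := eq_one_of_fixed_point (x := T / τ) hP.nonneg hP.zero_pos hP.hasSum hP.mean
      (div_nonneg hT0 hτ0.le) (by
        have h2 : HasSum (fun j => PowerSeries.coeff j ψ * T ^ j) (value ψ T) := hTs.hasSum
        have h3 := h2.div_const (value ψ τ)
        have e : value ψ T / value ψ τ = T / τ := by
          rw [div_eq_div_iff hv.ne' hτ0.ne']
          linear_combination -(value ψ T) * hfix - value ψ τ * hTfix
        rw [e] at h3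
        refine h3.congr_fun fun j => ?_
        rw [coeff_khinchinLaw, div_pow]
        field_simp)
    rwa [div_eq_one_iff_eq hτ0.ne'] at h1
  obtain ⟨K, hK, hlim⟩ := hP.tendsto_sqrt_mul_coeff
  refine ⟨τ * K, mul_pos hτ0 hK, hfn, fun n hn => ?_, hTeq ▸ hT, ?_⟩
  · rw [hf, PowerSeries.coeff_rescale] at hn
    exact hg.suppMod (suppMod_period hψ) n (right_ne_zero_of_mul hn)
  · refine (hlim.const_mul τ).congr' ?_
    filter_upwards [(eventually_gt_atTop 0).filter_mono inf_le_left] with n hn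
    have h1 := hg.coeff_eq hn
    rw [coeff_khinchinLaw_pow, ← h1, hf, PowerSeries.coeff_rescale, threeHalves, hρ, div_pow]
    obtain ⟨m, rfl⟩ := Nat.exists_eq_succ_of_ne_zero hn.ne'
    rw [Nat.succ_sub_one, pow_succ τ m]
    ring

theorem CoeffAsymp.sub_const {Q r : ℕ} {f : PowerSeries ℝ} {c S : ℝ} (h : CoeffAsymp Q r f c S) :
    CoeffAsymp Q r (f - PowerSeries.C (PowerSeries.coeff 0 f)) c (S - PowerSeries.coeff 0 f) := by
  have hcoeff : ∀ n, PowerSeries.coeff n (f - PowerSeries.C (PowerSeries.coeff 0 f)) =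
      if n = 0 then 0 else PowerSeries.coeff n f := by
    intro n
    rw [map_sub, PowerSeries.coeff_C]
    split_ifs with hn
    · rw [hn, sub_self]
    · rw [sub_zero]
  refine ⟨fun n => ?_, fun n hn => ?_, ?_, ?_⟩
  · rw [hcoeff]
    split_ifs
    exacts [le_rfl, h.nonneg n]
  · rw [hcoeff] at hn
    exact h.supp n fun h0 => hn (by rw [h0, ite_self])
  · refine (h.hasSum.sub (hasSum_ite_eq 0 (PowerSeries.coeff 0 f))).congr_fun fun n => ?_
    rw [map_sub, PowerSeries.coeff_C]
  · refine h.tendsto.congr' ?_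
    filter_upwards [(eventually_gt_atTop 0).filter_mono inf_le_left] with n hn
    rw [hcoeff, if_neg hn.ne']

theorem CoeffAsymp.smul_X (Q : ℕ) {ρ : ℝ} (hρ : 0 ≤ ρ) :
    CoeffAsymp Q 1 (ρ • PowerSeries.X) 0 ρ := by
  have hcoeff : ∀ n, PowerSeries.coeff n (ρ • PowerSeries.X : PowerSeries ℝ) =
      if n = 1 then ρ else 0 := by
    intro n
    rw [PowerSeries.coeff_smul, PowerSeries.coeff_X, smul_eq_mul, mul_ite, mul_one, mul_zero]
  refine ⟨fun n => ?_, fun n hn => ?_, ?_, ?_⟩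
  · rw [hcoeff]
    split_ifs
    exacts [hρ, le_rfl]
  · rw [hcoeff] at hn
    have : n = 1 := by
      by_contra h
      exact hn (if_neg h)
    rw [this]
  · simpa only [hcoeff] using hasSum_ite_eq 1 ρ
  · refine Tendsto.congr' ?_ tendsto_const_nhds
    filter_upwards [(eventually_gt_atTop 1).filter_mono inf_le_left] with n hn
    rw [hcoeff, if_neg hn.ne', mul_zero]

theorem coeff_zero_subst {f : PowerSeries ℝ} (hf : PowerSeries.coeff 0 f = 0)
    (ψ : PowerSeries ℝ) :
    PowerSeries.coeff 0 (PowerSeries.subst f ψ) = PowerSeries.coeff 0 ψ := by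
  have h1 := hasSum_single 0 (f := fun j => PowerSeries.coeff j ψ * PowerSeries.coeff 0 (f ^ j))
    fun j hj => by rw [coeff_pow_eq_zero_of_lt hf (Nat.pos_of_ne_zero hj), mul_zero]
  have h2 := (hasSum_coeff_subst hf ψ 0).unique h1
  simpa using h2

theorem hasDerivAt_value {ψ : PowerSeries ℝ} (hψ : ∀ n, 0 ≤ PowerSeries.coeff n ψ) {S s r : ℝ}
    (hS : 0 ≤ S) (hSs : S < s) (hsr : s < r)
    (hr : Summable fun j => PowerSeries.coeff j ψ * r ^ j) :
    HasDerivAt (fun w : ℂ => value ψ w)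
      ((∑' j : ℕ, PowerSeries.coeff j ψ * (j * S ^ (j - 1)) : ℝ) : ℂ) (S : ℂ) := by
  have hs : 0 < s := hS.trans_lt hSs
  have hu : Summable fun j : ℕ => PowerSeries.coeff j ψ * (j * s ^ (j - 1)) := by
    refine ((summable_coeff_mul_natPow hs hsr hψ hr 1).div_const s).congr fun j => ?_
    rcases j with _ | j
    · simp
    · rw [Nat.add_sub_cancel, pow_succ s j]; field_simp
  have hmem : (S : ℂ) ∈ Metric.ball (0 : ℂ) s := by
    rw [mem_ball_zero_iff, Complex.norm_real, Real.norm_of_nonneg hS]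
    exact hSs
  have h := hasDerivAt_tsum_of_isPreconnected (𝕜 := ℂ) (t := Metric.ball (0 : ℂ) s) hu
    Metric.isOpen_ball (convex_ball _ _).isPreconnected
    (g := fun j w => ((PowerSeries.coeff j ψ : ℝ) : ℂ) * w ^ j)
    (g' := fun j w => ((PowerSeries.coeff j ψ : ℝ) : ℂ) * (j * w ^ (j - 1)))
    (y₀ := 0) (y := S)
    (fun j w _ => (hasDerivAt_pow j w).const_mul _)
    (fun j w hw => by
      rw [norm_mul, norm_mul, norm_pow, Complex.norm_real, Real.norm_of_nonneg (hψ j),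
        Complex.norm_natCast]
      have h1 := hψ j
      have h2 : ‖w‖ ≤ s := (mem_ball_zero_iff.1 hw).le
      gcongr)
    (Metric.mem_ball_self hs)
    (summable_of_ne_finset_zero (s := {0}) fun j hj => by
      rw [zero_pow (by simpa using hj), mul_zero]) hmem
  have e : ((∑' j : ℕ, PowerSeries.coeff j ψ * (j * S ^ (j - 1)) : ℝ) : ℂ) =
      ∑' j : ℕ, ((PowerSeries.coeff j ψ : ℝ) : ℂ) * (j * (S : ℂ) ^ (j - 1)) := by
    rw [Complex.ofReal_tsum]
    exact tsum_congr fun j => by push_cast; rfl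
  rw [e]
  exact h

theorem value_ofReal (ψ : PowerSeries ℝ) (S : ℝ) : value ψ (S : ℂ) = ((value ψ S : ℝ) : ℂ) := by
  unfold value
  rw [Complex.ofReal_tsum]
  exact tsum_congr fun j => by simp

/-- The rescaled iterate `g_k(ρ z)` has coefficient sum `S = G_k(ρ, τ)`, and its asymptotic constant
is that of `g(ρ z)` times `d = ∂G_k/∂w (ρ, τ)`: both sides obey the chain rule. -/
theorem exists_coeffAsymp_iterSeries {ψ g : PowerSeries ℝ} {τ ρ c : ℝ} (hψ : ClassK ψ)
    (hτ : IsApex ψ τ) (hρ : ρ = τ / value ψ τ) (hg0 : PowerSeries.coeff 0 g = 0)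
    (hc : CoeffAsymp (period ψ) 1 (PowerSeries.rescale ρ g) c τ) (k : ℕ) :
    ∃ d S : ℝ, CoeffAsymp (period ψ) 1 (PowerSeries.rescale ρ (iterSeries ψ g k)) (d * c) S ∧
      S ≤ τ ∧ PowerSeries.coeff 0 (iterSeries ψ g k) = 0 ∧ iterG ψ k ρ τ = (S : ℂ) ∧
      HasDerivAt (fun w : ℂ => iterG ψ k ρ w) (d : ℂ) (τ : ℂ) := by
  have hv := hτ.value_pos hψ
  have hτ0 := hτ.pos
  have hρ0 : 0 < ρ := hρ ▸ div_pos hτ0 hv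
  have hfix : ρ * value ψ τ = τ := by rw [hρ, div_mul_cancel₀ _ hv.ne']
  obtain ⟨r, hr, hs⟩ := hτ.exists_summable hψ
  induction k with
  | zero =>
    refine ⟨1, τ, by rwa [one_mul], le_rfl, hg0, rfl, ?_⟩
    rw [Complex.ofReal_one]
    exact hasDerivAt_id _
  | succ k ih =>
    obtain ⟨d, S, hA, hSτ, h0, hG, hD⟩ := ih
    set F := PowerSeries.rescale ρ (iterSeries ψ g k) with hF
    have hF0 : PowerSeries.coeff 0 F = 0 := by
      rw [hF, PowerSeries.coeff_rescale, h0, mul_zero]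
    have hS0 : 0 ≤ S := hA.hasSum.nonneg hA.nonneg
    have hsub := (hA.subst hF0 hτ0 hSτ hr hψ.coeff_nonneg (suppMod_period hψ) hs).sub_const
    rw [coeff_zero_subst hF0] at hsub
    have hstep := (CoeffAsymp.smul_X (period ψ) hρ0.le).mul hsub
    have hser : PowerSeries.rescale ρ (iterSeries ψ g (k + 1)) =
        ρ • PowerSeries.X * (PowerSeries.subst F ψ - PowerSeries.C (PowerSeries.coeff 0 ψ)) := by
      rw [iterSeries, map_mul, map_sub, rescale_subst h0, PowerSeries.rescale_X]
      congr 1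
      · rw [PowerSeries.smul_eq_C_mul]
      · congr 1
        ext n
        rw [PowerSeries.coeff_rescale, PowerSeries.coeff_C]
        split_ifs with hn
        · rw [hn, pow_zero, one_mul]
        · rw [mul_zero]
    set E := ∑' j : ℕ, PowerSeries.coeff j ψ * (j * S ^ (j - 1)) with hE
    refine ⟨ρ * (E * d), ρ * (value ψ S - PowerSeries.coeff 0 ψ), ?_, ?_, ?_, ?_, ?_⟩
    · rw [hser]
      convert hstep using 1
      ring
    · have hmono : value ψ S ≤ value ψ τ := by
        refine hasSum_le (fun j => ?_) (summable_coeff_mul_pow_of_le hψ.coeff_nonneg hS0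
          (hSτ.trans hr.le) hs).hasSum (hτ.hasSum_value hψ)
        exact mul_le_mul_of_nonneg_left (pow_le_pow_left₀ hS0 hSτ j) (hψ.coeff_nonneg j)
      have hb := hψ.coeff_zero_pos
      calc _ ≤ ρ * value ψ τ := by gcongr; linarith
        _ = τ := hfix
    · rw [iterSeries]; simp
    · rw [iterG, hG, G, value_ofReal]
      push_cast
      rfl
    · obtain ⟨s, hs1, hs2⟩ := exists_between hr
      have h1 := hasDerivAt_value hψ.coeff_nonneg hS0 (hSτ.trans_lt hs1) hs2 hs
      rw [← hE, ← hG] at h1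
      have h2 := ((h1.comp (τ : ℂ) hD).sub_const
        ((PowerSeries.coeff 0 ψ : ℝ) : ℂ)).const_mul (ρ : ℂ)
      push_cast
      exact h2

end Khinchin

theorem mainTheorem1 (ψ : PowerSeries ℝ) (hψ : Khinchin.ClassKStar ψ)
    (τ : ℝ) (hτ : Khinchin.IsApex ψ τ)
    (ρ : ℝ) (hρ : ρ = τ / Khinchin.value ψ τ)
    (g : PowerSeries ℝ) (hg : Khinchin.IsLagrangeSolution ψ g) (k : ℕ) :
    DifferentiableAt ℂ (fun w : ℂ => Khinchin.iterG ψ k (ρ : ℂ) w) (τ : ℂ) ∧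
    Tendsto
      (fun n : ℕ => ((PowerSeries.coeff n (Khinchin.iterSeries ψ g k) /
        PowerSeries.coeff n g : ℝ) : ℂ))
      (atTop ⊓ 𝓟 {n : ℕ | n ≡ 1 [MOD Khinchin.period ψ]})
      (𝓝 (deriv (fun w : ℂ => Khinchin.iterG ψ k (ρ : ℂ) w) (τ : ℂ))) := by
  have hK := hψ.toClassK
  obtain ⟨c, hc, hA⟩ := hg.exists_coeffAsymp hK hτ hρ
  obtain ⟨d, S, hB, -, -, -, hD⟩ :=
    Khinchin.exists_coeffAsymp_iterSeries hK hτ hρ hg.coeff_zero hA k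
  refine ⟨hD.differentiableAt, ?_⟩
  rw [hD.deriv]
  refine (Complex.continuous_ofReal.tendsto d).comp ?_
  have hlim := hB.tendsto.div hA.tendsto hc.ne'
  rw [mul_div_cancel_right₀ _ hc.ne'] at hlim
  refine hlim.congr' ?_
  filter_upwards [(eventually_gt_atTop 0).filter_mono inf_le_left] with n hn
  have hρ0 : 0 < ρ := hρ ▸ div_pos hτ.pos (hτ.value_pos hK)
  rw [Pi.div_apply, PowerSeries.coeff_rescale, PowerSeries.coeff_rescale,
    mul_div_mul_left _ _ (Khinchin.threeHalves_pos hn).ne',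
    mul_div_mul_left _ _ (pow_pos hρ0 n).ne']
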